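/- Let $\mathbb{X}$ be a semi-abelian category, that is, a pointed category which is Barr exact (finitely complete, regular, and such that every internal equivalence relation is a kernel pair), Bourn protomodular, and has binary coproducts. For an object $B$ let $\mathsf{Pt}_B(\mathbb{X})$ be the category of points over $B$, i.e. of split epimorphisms $p\colon A\to B$ with a chosen section $s\colon B\to A$, with morphisms over $B$ compatible with the sections, and let $(\mathbb{X}\downarrow B)$ be the slice category over $B$. Each $p\colon E\to B$ induces, by pulling back, change of base functors $p^*\colon \mathsf{Pt}_B(\mathbb{X})\to\mathsf{Pt}_E(\mathbb{X})$ (of the fibration of points) and $p^*\colon(\mathbb{X}\downarrow B)\to(\mathbb{X}\downarrow E)$ (of the basic fibration $\mathsf{Arr}(\mathbb{X})\to\mathbb{X}$); protomodularity means that all the functors $p^*\colon \mathsf{Pt}_B(\mathbb{X})\to\mathsf{Pt}_E(\mathbb{X})$ reflect isomorphisms. Two morphisms $k\colon K\to X$, $l\colon L\to X$ in a pointed category with binary products commute (in the sense of Huq) if there is $\varphi\colon K\times L\to X$ with $\varphi\langle 1_K,0\rangle=k$ and $\varphi\langle 0,1_L\rangle=l$; a normal subobject is a kernel. Two equivalence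 relations $(r_1,r_2)\colon R\rightrightarrows X$ and $(s_1,s_2)\colon S\rightrightarrows X$ centralise each other (commute in the sense of Smith) if there is a morphism $\theta\colon R\times_X S\to X$, where $R\times_XS$ is the pullback of $r_2$ and $s_1$, such that $\theta(x,y,y)=x$ and $\theta(x,x,z)=z$ for generalised elements. The normalisation of $(r_1,r_2)$ is the composite of $\ker(r_1)\colon \mathrm{Ker}(r_1)\to R$ with $r_2\colon R\to X$. Then the following conditions are equivalent: (i) the Smith is Huq condition (SH): any two equivalence relations on the same object of $\mathbb{X}$ centralise each other as soon as their normalisations commute; (ii) condition (C): for every $p\colon E\to B$ in $\mathbb{X}$, the functor $p^*\colon \mathsf{Pt}_B(\mathbb{X})\to\mathsf{Pt}_E(\mathbb{X})$ reflects the commutation of normal subobjects; (iii) condition ($\overline{\mathrm{C}}$): for every $p\colon E\to B$ in $\mathbb{X}$, the functor $p^*\colon \mathsf{Pt}_B(\mathbb{X})\to\mathsf{Pt}_E(\mathbb{X})$ reflects the centralisation of equivalence relations; (iv) for every $p\colon E\to B$ in $\mathbb{X}$, the functor $p^*\colon (\mathbb{X}\downarrow B)\to(\mathbb{X}\downarrow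 E)$ reflects the centralisation of equivalence relations. -/

import Mathlib

open CategoryTheory CategoryTheory.Limits

universe v u

namespace SmithHuq

section Points

variable {C : Type u} [Category.{v} C]

/-- A point over `B`: a split epimorphism `p : A ⟶ B` with a chosen section `s`. -/
structure Pt (B : C) where
  /-- the domain of the split epimorphism -/
  A : C
  /-- the split epimorphism -/
  p : A ⟶ B
  /-- the chosen section -/
  s : B ⟶ A
  s_p : s ≫ p = 𝟙 B

namespace Pt

attribute [simp] Pt.s_p

/-- A morphism of points over `B` commutes with the split epimorphisms and with the sections. -/
@[ext]
structure Hom {B : C} (X Y : Pt B) where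
  /-- the underlying morphism -/
  hom : X.A ⟶ Y.A
  w_p : hom ≫ Y.p = X.p
  w_s : X.s ≫ hom = Y.s

attribute [simp] Hom.w_p Hom.w_s

/-- The category `Pt_B(C)` of points over `B`. -/
instance category (B : C) : Category.{v} (Pt B) where
  Hom X Y := Hom X Y
  id X := ⟨𝟙 X.A, by simp, by simp⟩
  comp f g := ⟨f.hom ≫ g.hom, by simp, by rw [← Category.assoc]; simp⟩
  id_comp _ := Hom.ext (Category.id_comp _)
  comp_id _ := Hom.ext (Category.comp_id _)
  assoc _ _ _ := Hom.ext (Category.assoc _ _ _)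

/-- `Pt_B(C)` is pointed, with zero object `(B, 𝟙 B, 𝟙 B)`: the zero morphism from `(A, p, s)` to
`(A', p', s')` is the composite of `p` with `s'`. -/
instance hasZeroMorphisms (B : C) : HasZeroMorphisms (Pt B) where
  zero X Y := ⟨⟨X.p ≫ Y.s, by simp, by rw [← Category.assoc]; simp⟩⟩
  comp_zero {X Y} f Z := Hom.ext (show f.hom ≫ Y.p ≫ Z.s = X.p ≫ Z.s by
    rw [← Category.assoc, f.w_p])
  zero_comp X {Y Z} f := Hom.ext (show (X.p ≫ Y.s) ≫ f.hom = X.p ≫ Z.s by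
    rw [Category.assoc, f.w_s])

/-- The pullback of a point over `B` along `p : E ⟶ B`. -/
@[simps]
noncomputable def changeOfBaseObj [HasPullbacks C] {E B : C} (p : E ⟶ B) (X : Pt B) : Pt E where
  A := pullback X.p p
  p := pullback.snd X.p p
  s := pullback.lift (p ≫ X.s) (𝟙 E) (by simp)
  s_p := pullback.lift_snd _ _ _

/-- The morphism induced on pullbacks along `p : E ⟶ B` by a morphism of points over `B`. -/
noncomputable def pullbackMap [HasPullbacks C] {E B : C} (p : E ⟶ B) {X Y : Pt B} (f : X ⟶ Y) :
    pullback X.p p ⟶ pullback Y.p p :=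
  pullback.lift (pullback.fst X.p p ≫ f.hom) (pullback.snd X.p p)
    (by rw [Category.assoc, f.w_p, pullback.condition])

@[simp]
lemma pullbackMap_fst [HasPullbacks C] {E B : C} (p : E ⟶ B) {X Y : Pt B} (f : X ⟶ Y) :
    pullbackMap p f ≫ pullback.fst Y.p p = pullback.fst X.p p ≫ f.hom :=
  pullback.lift_fst _ _ _

@[simp]
lemma pullbackMap_snd [HasPullbacks C] {E B : C} (p : E ⟶ B) {X Y : Pt B} (f : X ⟶ Y) :
    pullbackMap p f ≫ pullback.snd Y.p p = pullback.snd X.p p :=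
  pullback.lift_snd _ _ _

/-- The change of base functor `p^* : Pt_B(C) ⥤ Pt_E(C)` of the fibration of points along
`p : E ⟶ B`, given by pulling back. -/
noncomputable def changeOfBase [HasPullbacks C] {E B : C} (p : E ⟶ B) : Pt B ⥤ Pt E where
  obj X := changeOfBaseObj p X
  map {X Y} f :=
    { hom := pullbackMap p f
      w_p := pullbackMap_snd p f
      w_s := by
        change pullback.lift (p ≫ X.s) (𝟙 E) _ ≫ pullbackMap p f = pullback.lift (p ≫ Y.s) (𝟙 E) _
        apply pullback.hom_ext
        · rw [Category.assoc, pullbackMap_fst, pullback.lift_fst_assoc, pullback.lift_fst,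
            Category.assoc, f.w_s]
        · rw [Category.assoc, pullbackMap_snd, pullback.lift_snd, pullback.lift_snd] }
  map_id X := by
    apply Hom.ext
    change pullbackMap p (𝟙 X) = 𝟙 (pullback X.p p)
    apply pullback.hom_ext
    · rw [pullbackMap_fst, Category.id_comp]
      exact Category.comp_id _
    · rw [pullbackMap_snd, Category.id_comp]
  map_comp {X Y Z} f g := by
    apply Hom.ext
    change pullbackMap p (f ≫ g) = pullbackMap p f ≫ pullbackMap p g
    apply pullback.hom_ext
    · rw [Category.assoc, pullbackMap_fst, pullbackMap_fst, ← Category.assoc, pullbackMap_fst,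
        Category.assoc]
      rfl
    · rw [Category.assoc, pullbackMap_snd, pullbackMap_snd, pullbackMap_snd]

end Pt

end Points

/-- A semi-abelian category: pointed, Barr exact (regular, with every equivalence relation a
kernel pair), Bourn protomodular (every change of base functor of the fibration of points reflects
isomorphisms), with binary coproducts. Finite completeness is part of `Regular`. -/
class SemiAbelian (C : Type u) [Category.{v} C] : Prop
    extends Regular C, HasZeroObject C, HasBinaryCoproducts C where
  exact : ∀ {R X : C} (r₁ r₂ : R ⟶ X), IsEquivalenceRelation r₁ r₂ →
    ∃ (Y : C) (f : X ⟶ Y), IsKernelPair f r₁ r₂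
  protomodular : ∀ {E B : C} (p : E ⟶ B), (Pt.changeOfBase p).ReflectsIsomorphisms

section Commutation

variable {C : Type u} [Category.{v} C]

/-- The relations `(r₁, r₂) : R ⇉ X` and `(s₁, s₂) : S ⇉ X` centralise each other (commute in the
sense of Smith): there is a connector, that is, a morphism `θ : R ×_X S ⟶ X` on the object of
triples `(x, y, z)` with `x R y` and `y S z`, such that `θ (x, y, y) = x` and `θ (x, x, z) = z`.
The two equations are expressed on generalised elements `t : T ⟶ R ×_X S`. -/
def Centralise {R S X : C} (r₁ r₂ : R ⟶ X) (s₁ s₂ : S ⟶ X) : Prop :=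
  ∃ (P : C) (π₁ : P ⟶ R) (π₂ : P ⟶ S) (_ : IsPullback π₁ π₂ r₂ s₁) (θ : P ⟶ X),
    (∀ ⦃T : C⦄ (t : T ⟶ P), t ≫ π₂ ≫ s₁ = t ≫ π₂ ≫ s₂ → t ≫ θ = t ≫ π₁ ≫ r₁) ∧
    (∀ ⦃T : C⦄ (t : T ⟶ P), t ≫ π₁ ≫ r₁ = t ≫ π₁ ≫ r₂ → t ≫ θ = t ≫ π₂ ≫ s₂)

/-- `k : K ⟶ X` and `l : L ⟶ X` commute in the sense of Huq: there is `φ : K × L ⟶ X` which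
restricts to `k` along `⟨1, 0⟩ : K ⟶ K × L` and to `l` along `⟨0, 1⟩ : L ⟶ K × L`. -/
def HuqCommute [HasZeroMorphisms C] {K L X : C} (k : K ⟶ X) (l : L ⟶ X) : Prop :=
  ∃ (P : C) (π₁ : P ⟶ K) (π₂ : P ⟶ L) (h : IsLimit (BinaryFan.mk π₁ π₂)) (φ : P ⟶ X),
    h.lift (BinaryFan.mk (𝟙 K) (0 : K ⟶ L)) ≫ φ = k ∧
    h.lift (BinaryFan.mk (0 : L ⟶ K) (𝟙 L)) ≫ φ = l

/-- The normalisation of the relation `(r₁, r₂) : R ⇉ X`: the morphism `Ker r₁ ⟶ R ⟶ X`, the last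
arrow being `r₂`. -/
noncomputable def normalisation [HasZeroMorphisms C] [HasKernels C] {R X : C} (r₁ r₂ : R ⟶ X) :
    kernel r₁ ⟶ X :=
  kernel.ι r₁ ≫ r₂

end Commutation

section Reflection

universe v' u'

variable {C : Type u} [Category.{v} C] {D : Type u'} [Category.{v'} D]

/-- The functor `F` reflects the centralisation of equivalence relations. -/
def ReflectsCentralisation (F : C ⥤ D) : Prop :=
  ∀ ⦃R S X : C⦄ (r₁ r₂ : R ⟶ X) (s₁ s₂ : S ⟶ X),
    IsEquivalenceRelation r₁ r₂ → IsEquivalenceRelation s₁ s₂ →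
    Centralise (F.map r₁) (F.map r₂) (F.map s₁) (F.map s₂) → Centralise r₁ r₂ s₁ s₂

/-- The functor `F` reflects the (Huq) commutation of normal subobjects, i.e. of kernels. -/
def ReflectsNormalCommutation [HasZeroMorphisms C] [HasZeroMorphisms D] (F : C ⥤ D) : Prop :=
  ∀ ⦃K L X : C⦄ (k : K ⟶ X) (l : L ⟶ X),
    Nonempty (NormalMono k) → Nonempty (NormalMono l) →
    HuqCommute (F.map k) (F.map l) → HuqCommute k l

end Reflection

section Conditions

variable (C : Type u) [Category.{v} C]

/-- The Smith is Huq condition (SH): two equivalence relations on the same object centralise each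
other as soon as their normalisations commute. -/
def SmithIsHuq [HasZeroMorphisms C] [HasKernels C] : Prop :=
  ∀ ⦃R S X : C⦄ (r₁ r₂ : R ⟶ X) (s₁ s₂ : S ⟶ X),
    IsEquivalenceRelation r₁ r₂ → IsEquivalenceRelation s₁ s₂ →
    HuqCommute (normalisation r₁ r₂) (normalisation s₁ s₂) → Centralise r₁ r₂ s₁ s₂

/-- Condition (C): change of base for the fibration of points reflects the commutation of normal
subobjects. -/
def ConditionC [HasPullbacks C] : Prop :=
  ∀ ⦃E B : C⦄ (p : E ⟶ B), ReflectsNormalCommutation (Pt.changeOfBase p)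

/-- Condition (C̄): change of base for the fibration of points reflects the centralisation of
equivalence relations. -/
def ConditionCBar [HasPullbacks C] : Prop :=
  ∀ ⦃E B : C⦄ (p : E ⟶ B), ReflectsCentralisation (Pt.changeOfBase p)

/-- Change of base for the basic fibration (the codomain functor `Arr(C) ⥤ C`, with fibres the
slice categories) reflects the centralisation of equivalence relations. -/
def BasicReflectsCentralisation [HasPullbacks C] : Prop :=
  ∀ ⦃E B : C⦄ (p : E ⟶ B), ReflectsCentralisation (Over.pullback p)

end Conditions

end SmithHuq

/-!
All four conditions are compared through generalised elements. An equivalence relation on `X` is a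
point over `X`, by its first projection and its diagonal, and its fibre over the zero object is its
normalisation; so a property that change of base reflects may be tested along `0 ⟶ X`, where it is
a property of normalisations.

* (i) ⇒ (ii): normal subobjects in `Pt B` commute if and only if the kernel pairs of the morphisms
  they are kernels of centralise each other; the normalisations of these kernel pairs live over
  `0 ⟶ B`, hence already commute after pulling back along any `E ⟶ B`.
* (ii) ⇒ (i): the inclusions of `R` and `S` in `X ⨯ X`, as points over `X`, are normal
  subobjects, and they commute if and only if `R` and `S` centralise each other.
* (i) ⇒ (iv): a connector over `E` restricts to triples `(x, 0, y)`, which do not see the base.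
* (iv) ⇒ (iii): by protomodularity, forgetting sections reflects and preserves connectors.
* (iii) ⇒ (i): let `T` be the point over `X` of triples `(x, y, z)` with `x R y` and `y S z`, where
  `R` is the kernel pair of `f`. The kernel pairs of `(x, y, z) ↦ (x, y)` and of
  `(x, y, z) ↦ (x, f z)` centralise each other if and only if `R` and `S` do. Over `0 ⟶ X` the
  object `T` splits as a product `Ker r₁ ⨯ Ker s₁`, because the normalisations commute, and
  the connector is constructed componentwise.
-/

namespace SmithHuq

attribute [local simp] pullback.lift_fst pullback.lift_snd pullback.lift_fst_assoc
  pullback.lift_snd_assoc prod.lift_fst prod.lift_snd prod.lift_fst_assoc prod.lift_snd_assoc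
  coprod.inl_desc coprod.inr_desc coprod.inl_desc_assoc coprod.inr_desc_assoc

namespace Pt

section Basic

variable {C : Type u} [Category.{v} C] {B : C}

@[simp]
lemma id_hom (X : Pt B) : Hom.hom (𝟙 X) = 𝟙 X.A := rfl

@[simp]
lemma comp_hom {X Y Z : Pt B} (f : X ⟶ Y) (g : Y ⟶ Z) : (f ≫ g).hom = f.hom ≫ g.hom := rfl

@[simp]
lemma zero_hom (X Y : Pt B) : Hom.hom (0 : X ⟶ Y) = X.p ≫ Y.s := rfl

@[ext]
lemma hom_ext {X Y : Pt B} {f g : X ⟶ Y} (h : f.hom = g.hom) : f = g := Hom.ext h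

/-- Constructor for morphisms of points, producing a morphism in the category `Pt B` rather than
a term of the structure `Pt.Hom`. -/
@[simps]
def homMk {X Y : Pt B} (f : X.A ⟶ Y.A) (w_p : f ≫ Y.p = X.p) (w_s : X.s ≫ f = Y.s) : X ⟶ Y :=
  Hom.mk f w_p w_s

@[simp]
lemma hom_p {X Y : Pt B} (f : X ⟶ Y) : f.hom ≫ Y.p = X.p := f.w_p

@[simp]
lemma hom_p_assoc {X Y : Pt B} (f : X ⟶ Y) {Z : C} (h : B ⟶ Z) :
    f.hom ≫ Y.p ≫ h = X.p ≫ h := by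
  rw [← Category.assoc, hom_p]

@[simp]
lemma s_hom {X Y : Pt B} (f : X ⟶ Y) : X.s ≫ f.hom = Y.s := f.w_s

variable (B) in
/-- The functor `Pt_B(C) ⥤ (C ↓ B)` forgetting the section of a point. -/
def toOver : Pt B ⥤ Over B where
  obj X := Over.mk X.p
  map f := Over.homMk f.hom f.w_p

variable (B) in
/-- The functor sending a point to its domain. -/
def forget : Pt B ⥤ C where
  obj X := X.A
  map f := f.hom

instance : (toOver B).Faithful where
  map_injective h := hom_ext congr(Over.Hom.left $h)

instance : (forget B).ReflectsIsomorphisms where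
  reflects {X Y} f hf := by
    have : IsIso f.hom := hf
    exact ⟨homMk (inv f.hom) (by rw [IsIso.inv_comp_eq, hom_p]) (by rw [IsIso.comp_inv_eq, s_hom]),
      hom_ext (IsIso.hom_inv_id f.hom), hom_ext (IsIso.inv_hom_id f.hom)⟩

/-- The point with trivial kernel, a zero object of the category of points. -/
def trivial (B : C) : Pt B where
  A := B
  p := 𝟙 B
  s := 𝟙 B
  s_p := Category.id_comp _

/-- The trivial point is terminal. -/
def trivialIsTerminal (B : C) : IsTerminal (trivial B) :=
  IsTerminal.ofUniqueHom (fun X ↦ homMk X.p (Category.comp_id _) X.s_p)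
    (fun _ m ↦ hom_ext ((Category.comp_id _).symm.trans (hom_p m)))

instance : HasTerminal (Pt B) := (trivialIsTerminal B).hasTerminal

lemma isPullback_of_hom {P X Y Z : Pt B} {a : P ⟶ X} {b : P ⟶ Y} {f : X ⟶ Z} {g : Y ⟶ Z}
    (h : IsPullback a.hom b.hom f.hom g.hom) : IsPullback a b f g where
  w := hom_ext h.w
  isLimit' := ⟨PullbackCone.IsLimit.mk _
    (fun s ↦ homMk (h.lift s.fst.hom s.snd.hom congr(Hom.hom $s.condition))
      (by rw [← hom_p a, h.lift_fst_assoc, hom_p])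
      (h.hom_ext (by rw [Category.assoc, h.lift_fst, s_hom, s_hom])
        (by rw [Category.assoc, h.lift_snd, s_hom, s_hom])))
    (fun s ↦ hom_ext (h.lift_fst _ _ _)) (fun s ↦ hom_ext (h.lift_snd _ _ _))
    (fun s m h₁ h₂ ↦ hom_ext (h.hom_ext
      (congr(Hom.hom $h₁).trans (h.lift_fst _ _ _).symm)
      (congr(Hom.hom $h₂).trans (h.lift_snd _ _ _).symm)))⟩

end Basic

section Pullbacks

variable {C : Type u} [Category.{v} C] [HasPullbacks C] {B : C}

lemma exists_isPullback_hom {X Y Z : Pt B} (f : X ⟶ Z) (g : Y ⟶ Z) :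
    ∃ (P : Pt B) (a : P ⟶ X) (b : P ⟶ Y), IsPullback a.hom b.hom f.hom g.hom := by
  let P : Pt B :=
    { A := pullback f.hom g.hom
      p := pullback.fst f.hom g.hom ≫ X.p
      s := pullback.lift X.s Y.s (by simp)
      s_p := by simp }
  have hY : pullback.snd f.hom g.hom ≫ Y.p = P.p := by
    rw [← hom_p g, ← pullback.condition_assoc, hom_p]
  exact ⟨P, homMk (pullback.fst f.hom g.hom) rfl (pullback.lift_fst _ _ _),
    homMk (pullback.snd f.hom g.hom) hY (pullback.lift_snd _ _ _),
    IsPullback.of_hasPullback f.hom g.hom⟩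

instance : HasPullbacks (Pt B) :=
  have {X Y Z : Pt B} {f : X ⟶ Z} {g : Y ⟶ Z} : HasLimit (cospan f g) := by
    obtain ⟨P, a, b, h⟩ := exists_isPullback_hom f g
    exact (isPullback_of_hom h).hasPullback
  hasPullbacks_of_hasLimit_cospan _

instance : HasBinaryProducts (Pt B) := hasBinaryProducts_of_hasTerminal_and_pullbacks _

@[simp]
lemma prod_lift_hom_comp_fst_hom {T K L : Pt B} (x : T ⟶ K) (y : T ⟶ L) :
    (prod.lift x y).hom ≫ (prod.fst : K ⨯ L ⟶ K).hom = x.hom :=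
  congr(Hom.hom $(prod.lift_fst x y))

@[simp]
lemma prod_lift_hom_comp_snd_hom {T K L : Pt B} (x : T ⟶ K) (y : T ⟶ L) :
    (prod.lift x y).hom ≫ (prod.snd : K ⨯ L ⟶ L).hom = y.hom :=
  congr(Hom.hom $(prod.lift_snd x y))

instance : PreservesLimitsOfShape WalkingCospan (forget B) where
  preservesLimit {K} := by
    suffices PreservesLimit (cospan (K.map WalkingCospan.Hom.inl) (K.map WalkingCospan.Hom.inr))
        (forget B) from preservesLimit_of_iso_diagram _ (diagramIsoCospan K).symm
    obtain ⟨P, a, b, h⟩ := exists_isPullback_hom (K.map WalkingCospan.Hom.inl)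
      (K.map WalkingCospan.Hom.inr)
    have h' := isPullback_of_hom h
    exact preservesLimit_of_preserves_limit_cone h'.isLimit
      ((isLimitMapConePullbackConeEquiv (forget B) h'.w).symm (IsPullback.isLimit h))

instance : PreservesLimitsOfShape WalkingCospan (toOver B) :=
  have : PreservesLimitsOfShape WalkingCospan (toOver B ⋙ Over.forget B) :=
    inferInstanceAs (PreservesLimitsOfShape WalkingCospan (forget B))
  have : ReflectsLimitsOfShape WalkingCospan (Over.forget B) :=
    reflectsLimitsOfShape_of_reflectsIsomorphisms
  preservesLimitsOfShape_of_reflects_of_preserves (toOver B) (Over.forget B)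

lemma isPullback_hom {P X Y Z : Pt B} {a : P ⟶ X} {b : P ⟶ Y} {f : X ⟶ Z} {g : Y ⟶ Z}
    (h : IsPullback a b f g) : IsPullback a.hom b.hom f.hom g.hom :=
  h.map (forget B)

lemma isPullback_of_isKernel {K X Y : Pt B} {k : K ⟶ X} {u : X ⟶ Y} {w : k ≫ u = 0}
    (h : IsLimit (KernelFork.ofι k w)) : IsPullback k.hom K.p u.hom Y.s := by
  have comp_hom_eq_zero {T : Pt B} (t : T ⟶ trivial B) :
      t ≫ (homMk Y.s Y.s_p (Category.id_comp _) : trivial B ⟶ Y) = 0 :=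
    hom_ext congr($((Category.comp_id t.hom).symm.trans (hom_p t)) ≫ Y.s)
  exact isPullback_hom (b := homMk K.p (Category.comp_id _) K.s_p)
    ⟨⟨w.trans (comp_hom_eq_zero _).symm⟩, ⟨PullbackCone.IsLimit.mk _
      (fun s ↦ h.lift (KernelFork.ofι s.fst (s.condition.trans (comp_hom_eq_zero _))))
      (fun s ↦ h.fac _ WalkingParallelPair.zero)
      (fun s ↦ (trivialIsTerminal B).hom_ext _ _)
      (fun s m h₁ _ ↦ Fork.IsLimit.hom_ext h
        (h₁.trans (h.fac (KernelFork.ofι s.fst _) WalkingParallelPair.zero).symm))⟩⟩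

lemma isPullback_of_isLimit_binaryFan {P K L : Pt B} {a : P ⟶ K} {b : P ⟶ L}
    (h : IsLimit (BinaryFan.mk a b)) : IsPullback a.hom b.hom K.p L.p :=
  isPullback_hom (IsPullback.of_is_product' h (trivialIsTerminal B))

end Pullbacks

end Pt

section Connectors

variable {C : Type u} [Category.{v} C] {R S X P : C} {r₁ r₂ : R ⟶ X} {s₁ s₂ : S ⟶ X}
  {ρ : P ⟶ R} {σ : P ⟶ S}

/-- The equations of a Smith connector, for a family `θ : P ⟶ X` indexed by triples `(x, y, z)`
whose halves `x R y` and `y S z` are given by `ρ : P ⟶ R` and `σ : P ⟶ S`. The object `P` need not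
be the object `R ×_X S` of all such triples. -/
structure IsConnector (r₁ r₂ : R ⟶ X) (s₁ s₂ : S ⟶ X) (ρ : P ⟶ R) (σ : P ⟶ S) (θ : P ⟶ X) :
    Prop where
  eq_left : ∀ ⦃T : C⦄ (t : T ⟶ P), t ≫ σ ≫ s₁ = t ≫ σ ≫ s₂ → t ≫ θ = t ≫ ρ ≫ r₁
  eq_right : ∀ ⦃T : C⦄ (t : T ⟶ P), t ≫ ρ ≫ r₁ = t ≫ ρ ≫ r₂ → t ≫ θ = t ≫ σ ≫ s₂

lemma IsConnector.centralise {θ : P ⟶ X} (hθ : IsConnector r₁ r₂ s₁ s₂ ρ σ θ)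
    (hP : IsPullback ρ σ r₂ s₁) : Centralise r₁ r₂ s₁ s₂ :=
  ⟨P, ρ, σ, hP, θ, hθ.eq_left, hθ.eq_right⟩

lemma Centralise.exists_isConnector (h : Centralise r₁ r₂ s₁ s₂) (w : ρ ≫ r₂ = σ ≫ s₁) :
    ∃ θ : P ⟶ X, IsConnector r₁ r₂ s₁ s₂ ρ σ θ := by
  obtain ⟨Q, π₁, π₂, hQ, θ, h₁, h₂⟩ := h
  refine ⟨hQ.lift ρ σ w ≫ θ, fun T t ht ↦ ?_, fun T t ht ↦ ?_⟩
  · simpa using h₁ (t ≫ hQ.lift ρ σ w) (by simpa using ht)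
  · simpa using h₂ (t ≫ hQ.lift ρ σ w) (by simpa using ht)

lemma eq_comp_refl (hs : ReflexiveRelation s₁ s₂) ⦃T : C⦄ {t : T ⟶ S}
    (ht : t ≫ s₁ = t ≫ s₂) : t = (t ≫ s₁) ≫ hs.r :=
  hs.right_cancellation _ _ (by simp [hs.reflexivity₁]) (by simp [hs.reflexivity₂, ht])

lemma isConnector_of_inclusions (hr : ReflexiveRelation r₁ r₂) (hs : ReflexiveRelation s₁ s₂)
    (hP : IsPullback ρ σ r₂ s₁) {i : R ⟶ P} {j : S ⟶ P} {θ : P ⟶ X}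
    (i₁ : i ≫ ρ = 𝟙 R) (i₂ : i ≫ σ = r₂ ≫ hs.r) (j₁ : j ≫ ρ = s₁ ≫ hr.r) (j₂ : j ≫ σ = 𝟙 S)
    (hi : i ≫ θ = r₁) (hj : j ≫ θ = s₂) : IsConnector r₁ r₂ s₁ s₂ ρ σ θ where
  eq_left T t ht := by
    have hσ : t ≫ σ = (t ≫ ρ ≫ r₂) ≫ hs.r := by
      rw [hP.w, ← Category.assoc t]
      exact eq_comp_refl hs (by simpa using ht)
    have ht' : t = (t ≫ ρ) ≫ i := hP.hom_ext (by simp [i₁]) (by simp [i₂, hσ])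
    rw [ht']
    simp [hi, reassoc_of% i₁]
  eq_right T t ht := by
    have hρ : t ≫ ρ = (t ≫ σ ≫ s₁) ≫ hr.r := by
      rw [← hP.w, ← ht, ← Category.assoc t]
      exact eq_comp_refl hr (by simpa using ht)
    have ht' : t = (t ≫ σ) ≫ j := hP.hom_ext (by simp [j₁, hρ]) (by simp [j₂])
    rw [ht']
    simp [hj, reassoc_of% j₂]

section Functor

universe v' u'

variable {D : Type u'} [Category.{v'} D]

lemma IsConnector.of_map (F : C ⥤ D) [F.Faithful] {θ : P ⟶ X}
    (hθ : IsConnector (F.map r₁) (F.map r₂) (F.map s₁) (F.map s₂) (F.map ρ) (F.map σ) (F.map θ)) :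
    IsConnector r₁ r₂ s₁ s₂ ρ σ θ where
  eq_left T t ht := F.map_injective <| by
    simpa only [F.map_comp] using hθ.eq_left (F.map t) (by simpa using congr(F.map $ht))
  eq_right T t ht := F.map_injective <| by
    simpa only [F.map_comp] using hθ.eq_right (F.map t) (by simpa using congr(F.map $ht))

lemma Centralise.map (F : C ⥤ D) [PreservesLimitsOfShape WalkingCospan F]
    [JointlyMono₂ (F.map r₁) (F.map r₂)] [JointlyMono₂ (F.map s₁) (F.map s₂)]
    (hr : ReflexiveRelation r₁ r₂) (hs : ReflexiveRelation s₁ s₂)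
    (h : Centralise r₁ r₂ s₁ s₂) : Centralise (F.map r₁) (F.map r₂) (F.map s₁) (F.map s₂) := by
  obtain ⟨P, ρ, σ, hP, θ, h₁, h₂⟩ := h
  let i : R ⟶ P := hP.lift (𝟙 R) (r₂ ≫ hs.r) (by simp [hs.reflexivity₁])
  let j : S ⟶ P := hP.lift (s₁ ≫ hr.r) (𝟙 S) (by simp [hr.reflexivity₂])
  have hi : i ≫ θ = r₁ := by
    simpa [i] using h₁ i (by simp [i, hs.reflexivity₁, hs.reflexivity₂])
  have hj : j ≫ θ = s₂ := by
    simpa [j] using h₂ j (by simp [j, hr.reflexivity₁, hr.reflexivity₂])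
  refine (isConnector_of_inclusions (hr.map F) (hs.map F) (hP.map F) (i := F.map i)
    (j := F.map j) (θ := F.map θ) ?_ ?_ ?_ ?_ ?_ ?_).centralise (hP.map F)
  · rw [← F.map_comp, hP.lift_fst, F.map_id]
  · exact (F.map_comp _ _).symm.trans ((congrArg F.map (hP.lift_snd _ _ _)).trans (F.map_comp _ _))
  · exact (F.map_comp _ _).symm.trans ((congrArg F.map (hP.lift_fst _ _ _)).trans (F.map_comp _ _))
  · rw [← F.map_comp, hP.lift_snd, F.map_id]
  · rw [← F.map_comp, hi]
  · rw [← F.map_comp, hj]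

lemma Centralise.exists_hom_of_adjunction {L : D ⥤ C} {F : C ⥤ D} (adj : L ⊣ F)
    (h : Centralise (F.map r₁) (F.map r₂) (F.map s₁) (F.map s₂)) {Q : D} {ρ : L.obj Q ⟶ R}
    {σ : L.obj Q ⟶ S} (w : ρ ≫ r₂ = σ ≫ s₁) :
    ∃ θ : L.obj Q ⟶ X,
      (∀ ⦃T : D⦄ (t : T ⟶ Q), L.map t ≫ σ ≫ s₁ = L.map t ≫ σ ≫ s₂ →
        L.map t ≫ θ = L.map t ≫ ρ ≫ r₁) ∧
      (∀ ⦃T : D⦄ (t : T ⟶ Q), L.map t ≫ ρ ≫ r₁ = L.map t ≫ ρ ≫ r₂ →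
        L.map t ≫ θ = L.map t ≫ σ ≫ s₂) := by
  have transpose {T : D} (t : T ⟶ Q) {A : C} (α : L.obj Q ⟶ A) (g : A ⟶ X) :
      adj.homEquiv _ _ (L.map t ≫ α ≫ g) = t ≫ adj.homEquiv _ _ α ≫ F.map g := by
    rw [adj.homEquiv_naturality_left, adj.homEquiv_naturality_right]
  obtain ⟨θ, hθ⟩ := h.exists_isConnector (ρ := adj.homEquiv _ _ ρ) (σ := adj.homEquiv _ _ σ)
    (by rw [← adj.homEquiv_naturality_right, w, adj.homEquiv_naturality_right])
  refine ⟨(adj.homEquiv _ _).symm θ, fun T t ht ↦ ?_, fun T t ht ↦ ?_⟩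
  all_goals
    apply (adj.homEquiv _ _).injective
    rw [adj.homEquiv_naturality_left, Equiv.apply_symm_apply, transpose]
  · exact hθ.eq_left t (by rw [← transpose, ← transpose, ht])
  · exact hθ.eq_right t (by rw [← transpose, ← transpose, ht])

end Functor

end Connectors

section JointlyMono

universe v' u'

variable {C : Type u} [Category.{v} C] {D : Type u'} [Category.{v'} D]

lemma jointlyMono₂_of_map (F : C ⥤ D) [F.Faithful] {R X : C} {r₁ r₂ : R ⟶ X}
    [h : JointlyMono₂ (F.map r₁) (F.map r₂)] : JointlyMono₂ r₁ r₂ where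
  right_cancellation Y f g h₁ h₂ := F.map_injective
    (h.right_cancellation _ _ (by simp only [← F.map_comp, h₁]) (by simp only [← F.map_comp, h₂]))

lemma jointlyMono₂_map_of_adjunction {L : D ⥤ C} {F : C ⥤ D} (adj : L ⊣ F) {R X : C}
    (r₁ r₂ : R ⟶ X) [h : JointlyMono₂ r₁ r₂] : JointlyMono₂ (F.map r₁) (F.map r₂) where
  right_cancellation Y f g h₁ h₂ := (adj.homEquiv _ _).symm.injective
    (h.right_cancellation _ _
      (by simp only [← adj.homEquiv_naturality_right_symm, h₁])
      (by simp only [← adj.homEquiv_naturality_right_symm, h₂]))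

lemma isEquivalenceRelation_map (F : C ⥤ D) [PreservesLimitsOfShape WalkingCospan F] {R X : C}
    {r₁ r₂ : R ⟶ X} [JointlyMono₂ (F.map r₁) (F.map r₂)] (h : IsEquivalenceRelation r₁ r₂) :
    IsEquivalenceRelation (F.map r₁) (F.map r₂) := by
  obtain ⟨⟨h⟩⟩ := h
  exact ⟨⟨{ h.toReflexiveRelation.map F, h.toSymmetricRelation.map F,
    h.toTransitiveRelation.map F with }⟩⟩

lemma isEquivalenceRelation_of_isKernelPair [HasPullbacks C] {R X Y : C} {f : X ⟶ Y}
    {r₁ r₂ : R ⟶ X} (h : IsKernelPair f r₁ r₂) : IsEquivalenceRelation r₁ r₂ :=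
  ⟨⟨h.equivalenceRelation f r₁ r₂ (pullback.isLimit r₂ r₁)⟩⟩

variable {E B : C}

instance jointlyMono₂_left {R X : Over B} (r₁ r₂ : R ⟶ X) [h : JointlyMono₂ r₁ r₂] :
    JointlyMono₂ r₁.left r₂.left where
  right_cancellation Y f g h₁ h₂ := by
    have hg : g ≫ R.hom = f ≫ R.hom := by rw [← Over.w r₁, reassoc_of% h₁]
    exact congr(Over.Hom.left $(h.right_cancellation (Over.homMk f rfl : Over.mk (f ≫ R.hom) ⟶ R)
      (Over.homMk g hg) (Over.OverMorphism.ext h₁) (Over.OverMorphism.ext h₂)))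

instance jointlyMono₂_overForget {R X : Over B} (r₁ r₂ : R ⟶ X) [JointlyMono₂ r₁ r₂] :
    JointlyMono₂ ((Over.forget B).map r₁) ((Over.forget B).map r₂) :=
  jointlyMono₂_left r₁ r₂

instance jointlyMono₂_overPullback [HasPullbacks C] (p : E ⟶ B) {R X : Over B} (r₁ r₂ : R ⟶ X)
    [JointlyMono₂ r₁ r₂] :
    JointlyMono₂ ((Over.pullback p).map r₁) ((Over.pullback p).map r₂) :=
  jointlyMono₂_map_of_adjunction (Over.mapPullbackAdj p) r₁ r₂

instance Pt.jointlyMono₂_hom [HasBinaryCoproducts C] {R X : Pt B} (r₁ r₂ : R ⟶ X)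
    [h : JointlyMono₂ r₁ r₂] : JointlyMono₂ r₁.hom r₂.hom where
  right_cancellation Y f g h₁ h₂ := by
    have hg : g ≫ R.p = f ≫ R.p := by rw [← hom_p r₁, reassoc_of% h₁]
    -- `Y ⨿ B` is the free point over `B` on the morphism `f ≫ R.p : Y ⟶ B`.
    let W : Pt B := ⟨Y ⨿ B, coprod.desc (f ≫ R.p) (𝟙 B), coprod.inr, coprod.inr_desc _ _⟩
    let f' : W ⟶ R := homMk (coprod.desc f R.s) (by ext <;> simp [W]) (coprod.inr_desc _ _)
    let g' : W ⟶ R := homMk (coprod.desc g R.s) (by ext <;> simp [W, hg]) (coprod.inr_desc _ _)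
    have hfg : f' = g' := h.right_cancellation f' g'
      (hom_ext (by ext <;> simp [f', g', h₁])) (hom_ext (by ext <;> simp [f', g', h₂]))
    simpa [f', g'] using congr(coprod.inl ≫ Hom.hom $hfg)

instance Pt.jointlyMono₂_forget [HasBinaryCoproducts C] {R X : Pt B} (r₁ r₂ : R ⟶ X)
    [JointlyMono₂ r₁ r₂] : JointlyMono₂ ((forget B).map r₁) ((forget B).map r₂) :=
  jointlyMono₂_hom r₁ r₂

instance Pt.jointlyMono₂_toOver [HasBinaryCoproducts C] {R X : Pt B} (r₁ r₂ : R ⟶ X)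
    [JointlyMono₂ r₁ r₂] : JointlyMono₂ ((toOver B).map r₁) ((toOver B).map r₂) :=
  have : JointlyMono₂ ((Over.forget B).map ((toOver B).map r₁))
      ((Over.forget B).map ((toOver B).map r₂)) := jointlyMono₂_forget r₁ r₂
  jointlyMono₂_of_map (Over.forget B)

instance Pt.jointlyMono₂_changeOfBase [HasPullbacks C] [HasBinaryCoproducts C] (p : E ⟶ B)
    {R X : Pt B} (r₁ r₂ : R ⟶ X) [JointlyMono₂ r₁ r₂] :
    JointlyMono₂ ((changeOfBase p).map r₁) ((changeOfBase p).map r₂) :=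
  have : JointlyMono₂ ((toOver E).map ((changeOfBase p).map r₁))
      ((toOver E).map ((changeOfBase p).map r₂)) :=
    jointlyMono₂_overPullback p ((toOver B).map r₁) ((toOver B).map r₂)
  jointlyMono₂_of_map (toOver E)

end JointlyMono

section Protomodular

variable {C : Type u} [Category.{v} C] [SemiAbelian C] {B : C}

lemma Pt.isIso_hom_of_fibre {E : C} (e : E ⟶ B) {X Y : Pt B} (f : X ⟶ Y)
    (inj : ∀ ⦃T : C⦄ (t t' : T ⟶ X.A) (c : T ⟶ E), t ≫ X.p = c ≫ e → t' ≫ X.p = c ≫ e →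
      t ≫ f.hom = t' ≫ f.hom → t = t')
    (surj : ∀ ⦃T : C⦄ (t : T ⟶ Y.A) (c : T ⟶ E), t ≫ Y.p = c ≫ e →
      ∃ t' : T ⟶ X.A, t' ≫ f.hom = t) : IsIso f.hom := by
  obtain ⟨t, ht⟩ := surj (pullback.fst Y.p e) (pullback.snd Y.p e) pullback.condition
  have htp : t ≫ X.p = pullback.snd Y.p e ≫ e := by
    rw [← hom_p f, reassoc_of% ht, pullback.condition]
  have : IsIso (pullbackMap e f) := by
    refine ⟨pullback.lift t (pullback.snd Y.p e) htp, pullback.hom_ext ?_ ?_,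
      pullback.hom_ext ?_ ?_⟩
    · exact inj _ _ (pullback.snd X.p e) (by simp [htp, reassoc_of% (pullbackMap_snd e f)])
        (by simp [pullback.condition]) (by simp [ht])
    all_goals simp [ht]
  have : IsIso ((forget E).map ((changeOfBase e).map f)) := this
  have : IsIso ((changeOfBase e).map f) := isIso_of_reflects_iso _ (forget E)
  have := SemiAbelian.protomodular e
  have : IsIso f := isIso_of_reflects_iso f (changeOfBase e)
  exact inferInstanceAs (IsIso ((forget B).map f))

lemma Pt.eq_of_fibre {E : C} (e : E ⟶ B) (A : Pt B) {Z : C} {a b : A.A ⟶ Z}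
    (hs : A.s ≫ a = A.s ≫ b)
    (hA : ∀ ⦃T : C⦄ (t : T ⟶ A.A) (c : T ⟶ E), t ≫ A.p = c ≫ e → t ≫ a = t ≫ b) : a = b := by
  let M : Pt B := ⟨equalizer a b, equalizer.ι a b ≫ A.p, equalizer.lift A.s hs, by simp⟩
  let f : M ⟶ A := homMk (equalizer.ι a b) rfl (equalizer.lift_ι _ _)
  have : IsIso (equalizer.ι a b) := isIso_hom_of_fibre e f
    (fun _ _ _ _ _ _ h ↦ (cancel_mono (equalizer.ι a b)).1 h)
    (fun _ t c h ↦ ⟨equalizer.lift t (hA t c h), equalizer.lift_ι _ _⟩)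
  rw [← cancel_epi (equalizer.ι a b), equalizer.condition]

lemma IsConnector.comp_eq {R S X P W : C} {r₁ r₂ : R ⟶ X} {s₁ s₂ : S ⟶ X} {π₁ : P ⟶ R}
    {π₂ : P ⟶ S} {θ : P ⟶ X} (hθ : IsConnector r₁ r₂ s₁ s₂ π₁ π₂ θ)
    (hP : IsPullback π₁ π₂ r₂ s₁) (hr : ReflexiveRelation r₁ r₂) (hs : ReflexiveRelation s₁ s₂)
    (q : X ⟶ W) (hqs : s₁ ≫ q = s₂ ≫ q) : θ ≫ q = π₁ ≫ r₁ ≫ q := by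
  let A : Pt S :=
    { A := P
      p := π₂
      s := hP.lift (s₁ ≫ hr.r) (𝟙 S) (by simp [hr.reflexivity₂])
      s_p := hP.lift_snd _ _ _ }
  refine Pt.eq_of_fibre hs.r A ?_ (fun T t c h ↦ ?_)
  · have : A.s ≫ θ = s₂ := by
      simpa [A] using hθ.eq_right A.s (by simp [A, hr.reflexivity₁, hr.reflexivity₂])
    rw [reassoc_of% this]
    simp [A, reassoc_of% hr.reflexivity₁, hqs]
  · have h' : t ≫ π₂ = c ≫ hs.r := h
    rw [← Category.assoc, hθ.eq_left t (by
      rw [reassoc_of% h', reassoc_of% h', hs.reflexivity₁, hs.reflexivity₂])]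
    simp

lemma centralise_of_left {R S X : Over B} {r₁ r₂ : R ⟶ X} {s₁ s₂ : S ⟶ X}
    (hr : ReflexiveRelation r₁ r₂) (hs : ReflexiveRelation s₁ s₂)
    (h : Centralise r₁.left r₂.left s₁.left s₂.left) : Centralise r₁ r₂ s₁ s₂ := by
  have := hr.toJointlyMono₂
  have := hs.toJointlyMono₂
  have hP := IsPullback.of_hasPullback r₂ s₁
  have hP' := hP.map (Over.forget B)
  obtain ⟨θ, hθ⟩ := h.exists_isConnector hP'.w
  have hθX : θ ≫ X.hom = (pullback r₂ s₁).hom := by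
    rw [hθ.comp_eq hP' (hr.map (Over.forget B)) (hs.map (Over.forget B)) X.hom
      ((Over.w s₁).trans (Over.w s₂).symm)]
    simp
  exact (IsConnector.of_map (Over.forget B) (θ := Over.homMk θ hθX) hθ).centralise hP

lemma Pt.centralise_of_toOver {R S X : Pt B} {r₁ r₂ : R ⟶ X} {s₁ s₂ : S ⟶ X}
    (h : Centralise ((toOver B).map r₁) ((toOver B).map r₂) ((toOver B).map s₁)
      ((toOver B).map s₂)) : Centralise r₁ r₂ s₁ s₂ := by
  have hP := IsPullback.of_hasPullback r₂ s₁
  obtain ⟨θ, hθ⟩ := h.exists_isConnector (hP.map (toOver B)).w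
  have hθs : (pullback r₂ s₁).s ≫ θ.left = X.s := by
    let t : Over.mk (𝟙 B) ⟶ (toOver B).obj (pullback r₂ s₁) :=
      Over.homMk (pullback r₂ s₁).s (s_p _)
    have ht (f : pullback r₂ s₁ ⟶ X) : t ≫ (toOver B).map f = Over.homMk X.s X.s_p :=
      Over.OverMorphism.ext (s_hom f)
    have htθ : t ≫ θ = Over.homMk X.s X.s_p :=
      (hθ.eq_left t ((ht (pullback.snd r₂ s₁ ≫ s₁)).trans
        (ht (pullback.snd r₂ s₁ ≫ s₂)).symm)).trans (ht (pullback.fst r₂ s₁ ≫ r₁))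
    exact congr(Over.Hom.left $htθ)
  exact (IsConnector.of_map (toOver B) (θ := homMk θ.left (Over.w θ) hθs) hθ).centralise hP

lemma Pt.centralise_of_hom {R S X : Pt B} {r₁ r₂ : R ⟶ X} {s₁ s₂ : S ⟶ X}
    (hr : ReflexiveRelation r₁ r₂) (hs : ReflexiveRelation s₁ s₂)
    (h : Centralise r₁.hom r₂.hom s₁.hom s₂.hom) : Centralise r₁ r₂ s₁ s₂ :=
  have := hr.toJointlyMono₂
  have := hs.toJointlyMono₂
  centralise_of_toOver (centralise_of_left (hr.map (toOver B)) (hs.map (toOver B)) h)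

variable [HasZeroMorphisms C]

open ZeroObject in
lemma Pt.isIso_hom_of_kernel {X Y : Pt B} (f : X ⟶ Y)
    (inj : ∀ ⦃T : C⦄ (t t' : T ⟶ X.A), t ≫ X.p = 0 → t' ≫ X.p = 0 →
      t ≫ f.hom = t' ≫ f.hom → t = t')
    (surj : ∀ ⦃T : C⦄ (t : T ⟶ Y.A), t ≫ Y.p = 0 → ∃ t' : T ⟶ X.A, t' ≫ f.hom = t) :
    IsIso f.hom :=
  isIso_hom_of_fibre (0 : (0 : C) ⟶ B) f
    (fun T t t' c h h' ↦ inj t t' (by simpa using h) (by simpa using h'))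
    (fun T t c h ↦ surj t (by simpa using h))

open ZeroObject in
lemma prod_hom_ext_of_sections {K L Z : C} {a b : K ⨯ L ⟶ Z}
    (hK : prod.lift (𝟙 K) 0 ≫ a = prod.lift (𝟙 K) 0 ≫ b)
    (hL : prod.lift 0 (𝟙 L) ≫ a = prod.lift 0 (𝟙 L) ≫ b) : a = b := by
  refine Pt.eq_of_fibre (0 : (0 : C) ⟶ L) ⟨K ⨯ L, prod.snd, prod.lift 0 (𝟙 L), by simp⟩ hL
    (fun T t c h ↦ ?_)
  have : t = (t ≫ prod.fst) ≫ prod.lift (𝟙 K) 0 := by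
    ext
    · simp
    · simpa using h
  rw [this, Category.assoc, Category.assoc, Category.assoc, Category.assoc, hK]

end Protomodular

lemma lift_binaryFan_mk {C : Type u} [Category.{v} C] [HasBinaryProducts C] {K L P T : C}
    {π₁ : P ⟶ K} {π₂ : P ⟶ L} (hP : IsLimit (BinaryFan.mk π₁ π₂)) (a : T ⟶ K) (b : T ⟶ L) :
    hP.lift (BinaryFan.mk a b) = prod.lift a b ≫ hP.lift (BinaryFan.mk prod.fst prod.snd) := by
  have fst {T : C} (a : T ⟶ K) (b : T ⟶ L) : hP.lift (BinaryFan.mk a b) ≫ π₁ = a :=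
    hP.fac _ ⟨WalkingPair.left⟩
  have snd {T : C} (a : T ⟶ K) (b : T ⟶ L) : hP.lift (BinaryFan.mk a b) ≫ π₂ = b :=
    hP.fac _ ⟨WalkingPair.right⟩
  exact BinaryFan.IsLimit.hom_ext hP (by simp [fst]) (by simp [snd])

section Huq

variable {C : Type u} [Category.{v} C] [HasZeroMorphisms C] {K L X Y : C} {k : K ⟶ X} {l : L ⟶ X}

lemma HuqCommute.comp (h : HuqCommute k l) (g : X ⟶ Y) : HuqCommute (k ≫ g) (l ≫ g) := by
  obtain ⟨P, π₁, π₂, hP, φ, hk, hl⟩ := h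
  exact ⟨P, π₁, π₂, hP, φ ≫ g, by rw [reassoc_of% hk], by rw [reassoc_of% hl]⟩

section Products

variable [HasBinaryProducts C]

lemma huqCommute_of_prod (φ : K ⨯ L ⟶ X) (hk : prod.lift (𝟙 K) 0 ≫ φ = k)
    (hl : prod.lift 0 (𝟙 L) ≫ φ = l) : HuqCommute k l := by
  have lift_eq {T : C} (a : T ⟶ K) (b : T ⟶ L) :
      (prodIsProd K L).lift (BinaryFan.mk a b) = prod.lift a b :=
    Limits.prod.hom_ext
      (((prodIsProd K L).fac _ ⟨WalkingPair.left⟩).trans (prod.lift_fst _ _).symm)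
      (((prodIsProd K L).fac _ ⟨WalkingPair.right⟩).trans (prod.lift_snd _ _).symm)
  exact ⟨K ⨯ L, prod.fst, prod.snd, prodIsProd K L, φ, by rw [lift_eq, hk], by rw [lift_eq, hl]⟩

lemma HuqCommute.exists_prod (h : HuqCommute k l) :
    ∃ φ : K ⨯ L ⟶ X, prod.lift (𝟙 K) 0 ≫ φ = k ∧ prod.lift 0 (𝟙 L) ≫ φ = l := by
  obtain ⟨P, π₁, π₂, hP, φ, rfl, rfl⟩ := h
  exact ⟨hP.lift (BinaryFan.mk prod.fst prod.snd) ≫ φ,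
    by rw [← Category.assoc, ← lift_binaryFan_mk], by rw [← Category.assoc, ← lift_binaryFan_mk]⟩

lemma HuqCommute.precomp {K' L' : C} (h : HuqCommute k l) (a : K' ⟶ K) (b : L' ⟶ L) :
    HuqCommute (a ≫ k) (b ≫ l) := by
  obtain ⟨φ, rfl, rfl⟩ := h.exists_prod
  exact huqCommute_of_prod (prod.map a b ≫ φ) (by simp [← Category.assoc, prod.comp_lift])
    (by simp [← Category.assoc, prod.comp_lift])

lemma HuqCommute.symm (h : HuqCommute k l) : HuqCommute l k := by
  obtain ⟨φ, rfl, rfl⟩ := h.exists_prod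
  exact huqCommute_of_prod (prod.lift prod.snd prod.fst ≫ φ)
    (by simp [← Category.assoc, prod.comp_lift]) (by simp [← Category.assoc, prod.comp_lift])

lemma huqCommute_of_centralise {R S Z : C} {f : X ⟶ Y} {g : X ⟶ Z} {r₁ r₂ : R ⟶ X}
    {s₁ s₂ : S ⟶ X} (hf : IsKernelPair f r₁ r₂) (hg : IsKernelPair g s₁ s₂)
    (hk : k ≫ f = 0) (hl : l ≫ g = 0) (h : Centralise r₁ r₂ s₁ s₂) : HuqCommute k l := by
  -- the triples `(k x, 0, l y)`
  let ρ : K ⨯ L ⟶ R := hf.lift (prod.fst ≫ k) 0 (by simp [hk])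
  let σ : K ⨯ L ⟶ S := hg.lift 0 (prod.snd ≫ l) (by simp [hl])
  obtain ⟨θ, hθ⟩ := h.exists_isConnector (show ρ ≫ r₂ = σ ≫ s₁ by simp [ρ, σ])
  refine huqCommute_of_prod θ ?_ ?_
  · simpa [ρ] using hθ.eq_left (prod.lift (𝟙 K) 0) (by simp [σ])
  · simpa [σ] using hθ.eq_right (prod.lift 0 (𝟙 L)) (by simp [ρ])

end Products

section Normalisation

variable [HasKernels C] {R : C} {r₁ r₂ : R ⟶ X} {f : X ⟶ Y}

lemma normalisation_comp_eq_zero (hf : IsKernelPair f r₁ r₂) : normalisation r₁ r₂ ≫ f = 0 := by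
  simp [normalisation, ← hf.w]

/-- The normalisation of the kernel pair of `f` is a kernel of `f`. -/
noncomputable def normalisationIsKernel (hf : IsKernelPair f r₁ r₂) :
    IsLimit (KernelFork.ofι (normalisation r₁ r₂) (normalisation_comp_eq_zero hf)) :=
  KernelFork.IsLimit.ofι _ _
    (fun t ht ↦ kernel.lift r₁ (hf.lift 0 t (by simp [ht])) (by simp))
    (fun t ht ↦ by simp [normalisation])
    (fun t ht m hm ↦ by
      rw [← cancel_mono (kernel.ι r₁)]
      refine hf.hom_ext (by simp) ?_
      simpa [normalisation] using hm)

end Normalisation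

lemma HuqCommute.of_comp_kernel [SemiAbelian C] {A B : C} {x : A ⟶ K} {y : B ⟶ K} {g : X ⟶ Y}
    {w : k ≫ g = 0} (hk : IsLimit (KernelFork.ofι k w)) (h : HuqCommute (x ≫ k) (y ≫ k)) :
    HuqCommute x y := by
  obtain ⟨φ, hx, hy⟩ := h.exists_prod
  have hφ : φ ≫ g = 0 := prod_hom_ext_of_sections (by simp [reassoc_of% hx, w])
    (by simp [reassoc_of% hy, w])
  obtain ⟨ψ, hψ : ψ ≫ k = φ⟩ := KernelFork.IsLimit.lift' hk φ hφ
  have cancel {T : C} {a b : T ⟶ K} (hab : a ≫ k = b ≫ k) : a = b := Fork.IsLimit.hom_ext hk hab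
  exact huqCommute_of_prod ψ (cancel (by rw [Category.assoc, hψ, hx]))
    (cancel (by rw [Category.assoc, hψ, hy]))

end Huq

lemma Pt.exists_isPullback_of_huqCommute {C : Type u} [Category.{v} C] [HasPullbacks C] {B : C}
    {K L X : Pt B} {k : K ⟶ X} {l : L ⟶ X} (h : HuqCommute k l) :
    ∃ (P : C) (π₁ : P ⟶ K.A) (π₂ : P ⟶ L.A) (_ : IsPullback π₁ π₂ K.p L.p) (φ : P ⟶ X.A),
      (∀ ⦃T : C⦄ (t : T ⟶ P), t ≫ π₂ = t ≫ π₁ ≫ K.p ≫ L.s → t ≫ φ = t ≫ π₁ ≫ k.hom) ∧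
      (∀ ⦃T : C⦄ (t : T ⟶ P), t ≫ π₁ = t ≫ π₂ ≫ L.p ≫ K.s → t ≫ φ = t ≫ π₂ ≫ l.hom) := by
  obtain ⟨φ, rfl, rfl⟩ := h.exists_prod
  have hP := isPullback_of_isLimit_binaryFan (prodIsProd K L)
  refine ⟨_, _, _, hP, φ.hom, fun T t ht ↦ ?_, fun T t ht ↦ ?_⟩
  · have : t = (t ≫ (prod.fst : K ⨯ L ⟶ K).hom) ≫ (prod.lift (𝟙 K) (0 : K ⟶ L)).hom :=
      hP.hom_ext (by simp) (by simp [ht])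
    rw [← Category.assoc, comp_hom, ← Category.assoc, ← this]
  · have : t = (t ≫ (prod.snd : K ⨯ L ⟶ L).hom) ≫ (prod.lift (0 : L ⟶ K) (𝟙 L)).hom :=
      hP.hom_ext (by simp [ht]) (by simp)
    rw [← Category.assoc, comp_hom, ← Category.assoc, ← this]

section SliceCategories

variable {C : Type u} [Category.{v} C] [HasZeroMorphisms C]

lemma huqCommute_normalisation_of_overPullback [HasPullbacks C] [HasBinaryProducts C]
    [HasKernels C] {E B : C} (p : E ⟶ B) {R S X : Over B} {r₁ r₂ : R ⟶ X} {s₁ s₂ : S ⟶ X}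
    (er : SymmetricRelation r₁ r₂)
    (h : Centralise ((Over.pullback p).map r₁) ((Over.pullback p).map r₂)
      ((Over.pullback p).map s₁) ((Over.pullback p).map s₂)) :
    HuqCommute (normalisation r₁.left r₂.left) (normalisation s₁.left s₂.left) := by
  let K := kernel r₁.left
  let L := kernel s₁.left
  let κ : K ⟶ R.left := kernel.ι r₁.left ≫ er.s.left
  let l : L ⟶ S.left := kernel.ι s₁.left
  have κ₁ : κ ≫ r₁.left = normalisation r₁.left r₂.left := by
    simp only [κ, normalisation, Category.assoc, ← Over.comp_left, er.symmetry₁]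
  have κ₂ : κ ≫ r₂.left = 0 := by
    simp only [κ, Category.assoc, ← Over.comp_left, er.symmetry₂]
    exact kernel.condition _
  have l₁ : l ≫ s₁.left = 0 := kernel.condition _
  have κB : κ ≫ R.hom = 0 := by rw [← Over.w r₂, reassoc_of% κ₂, zero_comp]
  have lB : l ≫ S.hom = 0 := by rw [← Over.w s₁, reassoc_of% l₁, zero_comp]
  let Q : Over E := Over.mk (0 : K ⨯ L ⟶ E)
  let ρ : (Over.map p).obj Q ⟶ R := Over.homMk (prod.fst ≫ κ) (by simp [Q, κB])
  let σ : (Over.map p).obj Q ⟶ S := Over.homMk (prod.snd ≫ l) (by simp [Q, lB])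
  have hρσ : ρ ≫ r₂ = σ ≫ s₁ := Over.OverMorphism.ext (by simp [ρ, σ, κ₂, l₁])
  obtain ⟨θ, h₁, h₂⟩ := h.exists_hom_of_adjunction (Over.mapPullbackAdj p) hρσ
  let i : Over.mk (0 : K ⟶ E) ⟶ Q := Over.homMk (prod.lift (𝟙 K) 0) comp_zero
  let j : Over.mk (0 : L ⟶ E) ⟶ Q := Over.homMk (prod.lift 0 (𝟙 L)) comp_zero
  refine huqCommute_of_prod θ.left ?_ ?_
  · have hθ := congr(Over.Hom.left $(h₁ i (Over.OverMorphism.ext (by simp [i, σ]))))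
    simpa [i, ρ, κ₁] using hθ
  · have hθ := congr(Over.Hom.left $(h₂ j (Over.OverMorphism.ext (by simp [j, ρ]))))
    have hL : prod.lift 0 (𝟙 L) ≫ θ.left = l ≫ s₂.left := by simpa [j, σ] using hθ
    exact hL

variable [SemiAbelian C]

theorem SmithIsHuq.basicReflectsCentralisation (h : SmithIsHuq C) :
    BasicReflectsCentralisation C := by
  intro E B p R S X r₁ r₂ s₁ s₂ hr hs hc
  obtain ⟨⟨er⟩⟩ := id hr
  obtain ⟨⟨es⟩⟩ := id hs
  have := er.toJointlyMono₂
  have := es.toJointlyMono₂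
  exact centralise_of_left er.toReflexiveRelation es.toReflexiveRelation
    (h _ _ _ _ (isEquivalenceRelation_map (Over.forget B) hr)
      (isEquivalenceRelation_map (Over.forget B) hs)
      (huqCommute_normalisation_of_overPullback p er.toSymmetricRelation hc))

end SliceCategories

theorem BasicReflectsCentralisation.conditionCBar {C : Type u} [Category.{v} C]
    [SemiAbelian C] (h : BasicReflectsCentralisation C) : ConditionCBar C := by
  intro E B p R S X r₁ r₂ s₁ s₂ hr hs hc
  obtain ⟨⟨er⟩⟩ := id hr
  obtain ⟨⟨es⟩⟩ := id hs
  have := er.toJointlyMono₂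
  have := es.toJointlyMono₂
  exact Pt.centralise_of_toOver (h p _ _ _ _ (isEquivalenceRelation_map (Pt.toOver B) hr)
    (isEquivalenceRelation_map (Pt.toOver B) hs)
    (hc.map (Pt.toOver E) (er.toReflexiveRelation.map (Pt.changeOfBase p))
      (es.toReflexiveRelation.map (Pt.changeOfBase p))))

section ConditionC

variable {C : Type u} [Category.{v} C] [HasZeroMorphisms C]

namespace Pt

variable [HasPullbacks C] {E B : C}

lemma huqCommute_comp_hom [HasBinaryProducts C] {K L X : Pt B} {k : K ⟶ X} {l : L ⟶ X}
    (h : HuqCommute k l) {K' L' : C} {a : K' ⟶ K.A} {b : L' ⟶ L.A} (ha : a ≫ K.p = 0)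
    (hb : b ≫ L.p = 0) : HuqCommute (a ≫ k.hom) (b ≫ l.hom) := by
  obtain ⟨P, π₁, π₂, hP, φ, hk, hl⟩ := exists_isPullback_of_huqCommute h
  let m : K' ⨯ L' ⟶ P := hP.lift (prod.fst ≫ a) (prod.snd ≫ b) (by simp [ha, hb])
  refine huqCommute_of_prod (m ≫ φ) ?_ ?_
  · simpa [m] using hk (prod.lift (𝟙 K') 0 ≫ m) (by simp [m, reassoc_of% ha])
  · simpa [m] using hl (prod.lift 0 (𝟙 L') ≫ m) (by simp [m, reassoc_of% hb])

lemma huqCommute_comp_hom_of_changeOfBase [HasBinaryProducts C] (p : E ⟶ B) {K L X : Pt B}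
    {k : K ⟶ X} {l : L ⟶ X} (h : HuqCommute ((changeOfBase p).map k) ((changeOfBase p).map l))
    {K' L' : C} {a : K' ⟶ K.A} {b : L' ⟶ L.A} (ha : a ≫ K.p = 0) (hb : b ≫ L.p = 0) :
    HuqCommute (a ≫ k.hom) (b ≫ l.hom) := by
  have comp_fst {K : Pt B} (k : K ⟶ X) {K' : C} (a : K' ⟶ K.A) (ha : a ≫ K.p = 0 ≫ p) :
      (pullback.lift a 0 ha ≫ pullbackMap p k) ≫ pullback.fst X.p p = a ≫ k.hom := by
    simp
  rw [← comp_fst k a (by simp [ha]), ← comp_fst l b (by simp [hb])]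
  exact (huqCommute_comp_hom h (pullback.lift_snd _ _ _) (pullback.lift_snd _ _ _)).comp _

lemma exists_comp_hom_eq_normalisation [HasKernels C] {K R X Y : Pt B} {k : K ⟶ X} {f : X ⟶ Y}
    {w : k ≫ f = 0} (hk : IsLimit (KernelFork.ofι k w)) {r₁ r₂ : R ⟶ X}
    (hf : IsKernelPair f r₁ r₂) :
    ∃ a : kernel r₁.hom ⟶ K.A, a ≫ K.p = 0 ∧ a ≫ k.hom = normalisation r₁.hom r₂.hom := by
  have hN : normalisation r₁.hom r₂.hom ≫ f.hom = 0 :=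
    normalisation_comp_eq_zero (isPullback_hom hf)
  have hK := isPullback_of_isKernel hk
  exact ⟨hK.lift _ 0 (by simp [hN]), hK.lift_snd _ _ _, hK.lift_fst _ _ _⟩

end Pt

theorem SmithIsHuq.conditionC [SemiAbelian C] (h : SmithIsHuq C) : ConditionC C := by
  intro E B p K L X k l ⟨nk⟩ ⟨nl⟩ hc
  have hf := IsPullback.of_hasPullback nk.g nk.g
  have hg := IsPullback.of_hasPullback nl.g nl.g
  have hf' := Pt.isPullback_hom hf
  have hg' := Pt.isPullback_hom hg
  obtain ⟨a, ha, hak⟩ := Pt.exists_comp_hom_eq_normalisation nk.isLimit hf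
  obtain ⟨b, hb, hbl⟩ := Pt.exists_comp_hom_eq_normalisation nl.isLimit hg
  have hN := Pt.huqCommute_comp_hom_of_changeOfBase p hc ha hb
  rw [hak, hbl] at hN
  have hrs := h _ _ _ _ (isEquivalenceRelation_of_isKernelPair hf')
    (isEquivalenceRelation_of_isKernelPair hg') hN
  obtain ⟨⟨er⟩⟩ := isEquivalenceRelation_of_isKernelPair hf
  obtain ⟨⟨es⟩⟩ := isEquivalenceRelation_of_isKernelPair hg
  exact huqCommute_of_centralise hf hg nk.w nl.w
    (Pt.centralise_of_hom er.toReflexiveRelation es.toReflexiveRelation hrs)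

end ConditionC

section RelationPoints

variable {C : Type u} [Category.{v} C] {R S X Y : C} {r₁ r₂ : R ⟶ X} {s₁ s₂ : S ⟶ X}

/-- A reflexive relation, viewed as a point over its base object by the first projection. -/
abbrev relationPt (hr : ReflexiveRelation r₁ r₂) : Pt X where
  A := R
  p := r₁
  s := hr.r
  s_p := hr.reflexivity₁

/-- The product `X ⨯ Y`, viewed as a point over `X` with section the graph of `f : X ⟶ Y`. -/
noncomputable abbrev graphPt [HasBinaryProducts C] (f : X ⟶ Y) : Pt X where
  A := X ⨯ Y
  p := prod.fst
  s := prod.lift (𝟙 X) f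
  s_p := prod.lift_fst _ _

/-- The inclusion of a relation on `X` into `X ⨯ X`, as a morphism of points over `X`. -/
noncomputable def relationInclusion [HasBinaryProducts C] (hr : ReflexiveRelation r₁ r₂) :
    relationPt hr ⟶ graphPt (𝟙 X) :=
  Pt.homMk (prod.lift r₁ r₂) (prod.lift_fst _ _)
    (by simp [prod.comp_lift, hr.reflexivity₁, hr.reflexivity₂])

lemma Pt.nonempty_normalMono_of_isPullback {B : C} {K X Y : Pt B} {k : K ⟶ X} {u : X ⟶ Y}
    (h : IsPullback k.hom K.p u.hom Y.s) : Nonempty (NormalMono k) :=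
  ⟨⟨Y, u, hom_ext h.w, KernelFork.IsLimit.ofι _ _
    (fun {W} t ht ↦ homMk (h.lift t.hom W.p congr(Hom.hom $ht)) (h.lift_snd _ _ _)
      (h.hom_ext (by simp) (by simp)))
    (fun t ht ↦ hom_ext (h.lift_fst _ _ _))
    (fun t ht m hm ↦ hom_ext (h.hom_ext
      (congr(Hom.hom $hm).trans (h.lift_fst _ _ _).symm)
      ((hom_p m).trans (h.lift_snd _ _ _).symm)))⟩⟩

lemma isPullback_of_isKernelPair [HasBinaryProducts C] {f : X ⟶ Y} (hf : IsKernelPair f r₁ r₂) :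
    IsPullback (prod.lift r₁ r₂) r₁ (prod.lift prod.fst (prod.snd ≫ f)) (prod.lift (𝟙 X) f) where
  w := by simp [prod.comp_lift, hf.w]
  isLimit' := ⟨PullbackCone.IsLimit.mk _
    (fun c ↦ hf.lift c.snd (c.fst ≫ prod.snd)
      (by simpa using congr($(c.condition.symm) ≫ prod.snd)))
    (fun c ↦ Limits.prod.hom_ext
      (by simpa using congr($(c.condition.symm) ≫ prod.fst)) (by simp))
    (fun c ↦ hf.lift_fst _ _ _)
    (fun c m h₁ h₂ ↦ hf.hom_ext (h₂.trans (hf.lift_fst _ _ _).symm)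
      (by simpa using congr($h₁ ≫ prod.snd)))⟩

lemma nonempty_normalMono_relationInclusion [HasBinaryProducts C] {f : X ⟶ Y}
    (hf : IsKernelPair f r₁ r₂) (hr : ReflexiveRelation r₁ r₂) :
    Nonempty (NormalMono (relationInclusion hr)) :=
  Pt.nonempty_normalMono_of_isPullback (Y := graphPt f)
    (u := Pt.homMk (prod.lift prod.fst (prod.snd ≫ f)) (prod.lift_fst _ _)
      (by simp [prod.comp_lift]))
    (isPullback_of_isKernelPair hf)

lemma centralise_of_huqCommute_relationInclusion [HasPullbacks C] [HasBinaryProducts C]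
    (er : SymmetricRelation r₁ r₂) (hr : ReflexiveRelation r₁ r₂) (hs : ReflexiveRelation s₁ s₂)
    (h : HuqCommute (relationInclusion hr) (relationInclusion hs)) :
    Centralise r₁ r₂ s₁ s₂ := by
  obtain ⟨P, p₁, p₂, hP, φ, hφr, hφs⟩ := Pt.exists_isPullback_of_huqCommute h
  let π₁ := pullback.fst r₂ s₁
  let π₂ := pullback.snd r₂ s₁
  have hπ : π₁ ≫ r₂ = π₂ ≫ s₁ := pullback.condition
  -- The triple `(x, y, z)` is sent to the pair of `y R x` and `y S z`.
  let m : pullback r₂ s₁ ⟶ P := hP.lift (π₁ ≫ er.s) π₂ (by simp [hπ, er.symmetry₁])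
  have m₁ : m ≫ p₁ = π₁ ≫ er.s := hP.lift_fst _ _ _
  have m₂ : m ≫ p₂ = π₂ := hP.lift_snd _ _ _
  refine IsConnector.centralise (θ := m ≫ φ ≫ prod.snd)
    ⟨fun T t ht ↦ ?_, fun T t ht ↦ ?_⟩ (IsPullback.of_hasPullback r₂ s₁)
  · have hσ : t ≫ π₂ = (t ≫ π₂ ≫ s₁) ≫ hs.r := by
      rw [← Category.assoc t]
      exact eq_comp_refl hs (by simpa using ht)
    have := hφr (t ≫ m) (by
      simp only [Category.assoc, m₂, reassoc_of% m₁, hσ, ← hπ, er.symmetry₁_assoc])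
    simp [reassoc_of% this, reassoc_of% m₁, relationInclusion, er.symmetry₂, π₁]
  · have hρ : t ≫ π₁ ≫ er.s = (t ≫ π₂ ≫ s₁) ≫ hr.r := by
      have := eq_comp_refl hr (t := t ≫ π₁ ≫ er.s)
        (by simpa [er.symmetry₁, er.symmetry₂] using ht.symm)
      simpa only [Category.assoc, er.symmetry₁_assoc, reassoc_of% hπ] using this
    have := hφs (t ≫ m) (by
      simp only [Category.assoc, m₁, reassoc_of% m₂, hρ])
    simp [reassoc_of% this, reassoc_of% m₂, relationInclusion, π₂]

end RelationPoints

section SmithIsHuqOfConditionC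

variable {C : Type u} [Category.{v} C] [HasZeroMorphisms C]

lemma Pt.huqCommute_of_hom [HasPullbacks C] [HasBinaryProducts C] {Z : C} (hZ : IsZero Z)
    {K L X : Pt Z} {k : K ⟶ X} {l : L ⟶ X} (h : HuqCommute k.hom l.hom) : HuqCommute k l := by
  obtain ⟨φ, hk, hl⟩ := h.exists_prod
  let m : (K ⨯ L).A ⟶ K.A ⨯ L.A :=
    prod.lift (prod.fst : K ⨯ L ⟶ K).hom (prod.snd : K ⨯ L ⟶ L).hom
  have hK : (prod.lift (𝟙 K) (0 : K ⟶ L)).hom ≫ m = prod.lift (𝟙 K.A) 0 := by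
    simp [m, prod.comp_lift, hZ.eq_of_tgt K.p 0]
  have hL : (prod.lift (0 : L ⟶ K) (𝟙 L)).hom ≫ m = prod.lift 0 (𝟙 L.A) := by
    simp [m, prod.comp_lift, hZ.eq_of_tgt L.p 0]
  exact huqCommute_of_prod (homMk (m ≫ φ) (hZ.eq_of_tgt _ _) (hZ.eq_of_src _ _))
    (hom_ext (by simp [reassoc_of% hK, hk])) (hom_ext (by simp [reassoc_of% hL, hl]))

lemma HuqCommute.changeOfBase_relationInclusion [HasPullbacks C] [HasBinaryProducts C]
    [HasKernels C] {R S X Z : C} {r₁ r₂ : R ⟶ X} {s₁ s₂ : S ⟶ X}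
    (h : HuqCommute (normalisation r₁ r₂) (normalisation s₁ s₂)) (hZ : IsZero Z) (z : Z ⟶ X)
    (hr : ReflexiveRelation r₁ r₂) (hs : ReflexiveRelation s₁ s₂) :
    HuqCommute ((Pt.changeOfBase z).map (relationInclusion hr))
      ((Pt.changeOfBase z).map (relationInclusion hs)) := by
  have hz : z = 0 := hZ.eq_of_src _ _
  let ι : X ⟶ pullback (graphPt (𝟙 X)).p z :=
    pullback.lift (prod.lift 0 (𝟙 X)) 0 (by simp)
  have factor {R : C} {r₁ r₂ : R ⟶ X} (hr : ReflexiveRelation r₁ r₂) :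
      ∃ x, x ≫ normalisation r₁ r₂ ≫ ι = Pt.pullbackMap z (relationInclusion hr) := by
    refine ⟨kernel.lift r₁ (pullback.fst r₁ z) (by simp [pullback.condition, hz]),
      pullback.hom_ext ?_ (hZ.eq_of_tgt _ _)⟩
    rw [Pt.pullbackMap_fst]
    apply Limits.prod.hom_ext <;>
      simp [ι, normalisation, relationInclusion, pullback.condition, hz]
  obtain ⟨x, hx⟩ := factor hr
  obtain ⟨y, hy⟩ := factor hs
  refine Pt.huqCommute_of_hom hZ ?_
  have hxy := (h.comp ι).precomp x y
  rw [hx, hy] at hxy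
  exact hxy

open ZeroObject in
theorem ConditionC.smithIsHuq [SemiAbelian C] (h : ConditionC C) : SmithIsHuq C := by
  intro R S X r₁ r₂ s₁ s₂ hr hs hN
  obtain ⟨Y, f, hf⟩ := SemiAbelian.exact r₁ r₂ hr
  obtain ⟨Z, g, hg⟩ := SemiAbelian.exact s₁ s₂ hs
  obtain ⟨⟨er⟩⟩ := hr
  obtain ⟨⟨es⟩⟩ := hs
  exact centralise_of_huqCommute_relationInclusion er.toSymmetricRelation er.toReflexiveRelation
    es.toReflexiveRelation (h (0 : (0 : C) ⟶ X) _ _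
      (nonempty_normalMono_relationInclusion hf er.toReflexiveRelation)
      (nonempty_normalMono_relationInclusion hg es.toReflexiveRelation)
      (hN.changeOfBase_relationInclusion (isZero_zero C) _ _ _))

end SmithIsHuqOfConditionC

section ProductDecompositions

variable {C : Type u} [Category.{v} C]

lemma centralise_of_isIso_prod_lift [HasPullbacks C] [HasBinaryProducts C]
    {A K L M R S Y : C} {a : A ⟶ K} {b : A ⟶ L} [IsIso (prod.lift a b)] {m₁ m₂ : M ⟶ L} {h : L ⟶ Y}
    (hh : IsKernelPair h m₁ m₂) (hL : Centralise (prod.fst : L ⨯ L ⟶ L) prod.snd m₁ m₂)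
    {r₁ r₂ : R ⟶ A} {s₁ s₂ : S ⟶ A} (hr : r₁ ≫ a = r₂ ≫ a) (hs : s₁ ≫ b ≫ h = s₂ ≫ b ≫ h) :
    Centralise r₁ r₂ s₁ s₂ := by
  have hP := IsPullback.of_hasPullback r₂ s₁
  let π₁ := pullback.fst r₂ s₁
  let π₂ := pullback.snd r₂ s₁
  have hπ : π₁ ≫ r₂ = π₂ ≫ s₁ := hP.w
  let ρ : pullback r₂ s₁ ⟶ L ⨯ L := prod.lift (π₁ ≫ r₁ ≫ b) (π₁ ≫ r₂ ≫ b)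
  let σ : pullback r₂ s₁ ⟶ M := hh.lift (π₂ ≫ s₁ ≫ b) (π₂ ≫ s₂ ≫ b) (by simp [hs])
  obtain ⟨θ, hθ⟩ := hL.exists_isConnector (ρ := ρ) (σ := σ) (by simp [ρ, σ, reassoc_of% hπ])
  refine IsConnector.centralise (θ := prod.lift (π₂ ≫ s₂ ≫ a) θ ≫ inv (prod.lift a b))
    ⟨fun T t ht ↦ ?_, fun T t ht ↦ ?_⟩ hP
  all_goals
    rw [← cancel_mono (prod.lift a b)]
    ext
    all_goals simp only [Category.assoc, IsIso.inv_hom_id, Category.comp_id, prod.lift_fst,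
      prod.lift_snd]
  · rw [← reassoc_of% ht, ← reassoc_of% hπ, hr]
  · simpa [ρ] using hθ.eq_left t (by simpa [σ] using congr($ht ≫ b))
  · rfl
  · simpa [σ] using hθ.eq_right t (by simpa [ρ] using congr($ht ≫ b))

lemma hom_ext_of_isPullback_of_isKernelPair {A K S X Y : C} {n : K ⟶ X} {s₁ s₂ : S ⟶ X} {g : X ⟶ Y}
    (hg : IsKernelPair g s₁ s₂) {q : A ⟶ K} {β : A ⟶ S} (hA : IsPullback q β n s₁) {T : C}
    {t t' : T ⟶ A} (h₁ : t ≫ q = t' ≫ q) (h₂ : t ≫ β ≫ s₂ = t' ≫ β ≫ s₂) : t = t' :=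
  hA.hom_ext h₁ (hg.hom_ext (by simp [← hA.w, reassoc_of% h₁]) (by simpa using h₂))

variable [HasZeroMorphisms C] [SemiAbelian C]

lemma isIso_of_comp_eq_fst_of_comp_eq {A K S X Y : C} {n : K ⟶ X} {s₁ s₂ : S ⟶ X} {g : X ⟶ Y}
    (hg : IsKernelPair g s₁ s₂) {q : A ⟶ K} {β : A ⟶ S} (hA : IsPullback q β n s₁)
    {φ : K ⨯ kernel s₁ ⟶ X} (hφ : prod.lift 0 (𝟙 (kernel s₁)) ≫ φ = normalisation s₁ s₂)
    {e : K ⨯ kernel s₁ ⟶ A} (eq : e ≫ q = prod.fst) (eβ : e ≫ β ≫ s₂ = φ) : IsIso e := by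
  let P : Pt K := ⟨K ⨯ kernel s₁, prod.fst, prod.lift (𝟙 K) 0, prod.lift_fst _ _⟩
  let Q : Pt K := ⟨A, q, prod.lift (𝟙 K) 0 ≫ e, by rw [Category.assoc, eq, prod.lift_fst]⟩
  have lift_comp {T : C} (t : T ⟶ kernel s₁) :
      prod.lift 0 t ≫ φ = t ≫ normalisation s₁ s₂ := by
    rw [← hφ, ← Category.assoc, prod.comp_lift, comp_zero, Category.comp_id]
  refine Pt.isIso_hom_of_kernel (Pt.homMk e eq rfl : P ⟶ Q)
    (fun T t t' (ht : t ≫ prod.fst = 0) (ht' : t' ≫ prod.fst = 0) (h : t ≫ e = t' ≫ e) ↦ ?_)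
    (fun T t (ht : t ≫ q = 0) ↦ ?_)
  · have comp_eq {u : T ⟶ K ⨯ kernel s₁} (hu : u ≫ prod.fst = 0) :
        u ≫ φ = (u ≫ prod.snd) ≫ normalisation s₁ s₂ := by
      rw [← lift_comp, ← hu, ← prod.comp_lift, prod.lift_fst_snd, Category.comp_id]
    refine Limits.prod.hom_ext (ht.trans ht'.symm)
      (Fork.IsLimit.hom_ext (normalisationIsKernel hg) ?_)
    have hφ : t ≫ φ = t' ≫ φ := by rw [← eβ, reassoc_of% h]
    exact (comp_eq ht).symm.trans (hφ.trans (comp_eq ht'))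
  · have hβ : (t ≫ β) ≫ s₁ = 0 := by rw [Category.assoc, ← hA.w, reassoc_of% ht, zero_comp]
    refine ⟨prod.lift 0 (kernel.lift s₁ (t ≫ β) hβ),
      hom_ext_of_isPullback_of_isKernelPair hg hA (t' := t) ?_ ?_⟩
    · simp [eq, ht]
    · simp [eβ, lift_comp, normalisation]

lemma exists_isIso_prod_lift {A K S X Y : C} {n : K ⟶ X} {s₁ s₂ : S ⟶ X} {g : X ⟶ Y}
    (hg : IsKernelPair g s₁ s₂) {q : A ⟶ K} {β : A ⟶ S} (hA : IsPullback q β n s₁)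
    {φ : K ⨯ kernel s₁ ⟶ X} (hφn : prod.lift (𝟙 K) 0 ≫ φ = n)
    (hφs : prod.lift 0 (𝟙 (kernel s₁)) ≫ φ = normalisation s₁ s₂) :
    ∃ b : A ⟶ kernel s₁, IsIso (prod.lift q b) ∧ prod.lift q b ≫ φ = β ≫ s₂ ∧
      ∀ ⦃T : C⦄ (t : T ⟶ A), t ≫ β ≫ s₁ = t ≫ β ≫ s₂ → t ≫ b = 0 := by
  have hφg : φ ≫ g = prod.fst ≫ n ≫ g := prod_hom_ext_of_sections (by simp [reassoc_of% hφn])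
    (by simp [reassoc_of% hφs, normalisation_comp_eq_zero hg])
  let e : K ⨯ kernel s₁ ⟶ A := hA.lift prod.fst (hg.lift (prod.fst ≫ n) φ (by simp [hφg]))
    (by simp)
  have eq : e ≫ q = prod.fst := hA.lift_fst _ _ _
  have eβ : e ≫ β ≫ s₂ = φ := by simp [e]
  have : IsIso e := isIso_of_comp_eq_fst_of_comp_eq hg hA hφs eq eβ
  have inv_fst : inv e ≫ prod.fst = q := by rw [IsIso.inv_comp_eq, eq]
  have hinv : prod.lift q (inv e ≫ prod.snd) = inv e := by ext <;> simp [inv_fst]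
  refine ⟨inv e ≫ prod.snd, by rw [hinv]; infer_instance, by rw [hinv, IsIso.inv_comp_eq, eβ],
    fun T t ht ↦ ?_⟩
  have : t = (t ≫ q) ≫ prod.lift (𝟙 K) 0 ≫ e :=
    hom_ext_of_isPullback_of_isKernelPair hg hA (by simp [eq]) (by simp [eβ, hφn, ← ht, hA.w])
  rw [this]
  simp

lemma centralise_prod_of_huqCommute_id {L S Y : C} {s₁ s₂ : S ⟶ L} {h : L ⟶ Y}
    (hh : IsKernelPair h s₁ s₂) (hc : HuqCommute (𝟙 L) (normalisation s₁ s₂)) :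
    Centralise (prod.fst : L ⨯ L ⟶ L) prod.snd s₁ s₂ := by
  obtain ⟨φ, hφ₁, hφ₂⟩ := hc.exists_prod
  obtain ⟨b, -, hb, hb₀⟩ := exists_isIso_prod_lift hh (IsPullback.id_horiz s₁).flip hφ₁ hφ₂
  let π₁ := pullback.fst (prod.snd : L ⨯ L ⟶ L) s₁
  let π₂ := pullback.snd (prod.snd : L ⨯ L ⟶ L) s₁
  have hπ : π₁ ≫ prod.snd = π₂ ≫ s₁ := pullback.condition
  refine IsConnector.centralise (ρ := π₁) (σ := π₂) (θ := prod.lift (π₁ ≫ prod.fst) (π₂ ≫ b) ≫ φ)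
    ⟨fun T t ht ↦ ?_, fun T t ht ↦ ?_⟩ (IsPullback.of_hasPullback _ _)
  · have hb₀ : t ≫ π₂ ≫ b = 0 := by simpa using hb₀ (t ≫ π₂) (by simpa using ht)
    have : t ≫ prod.lift (π₁ ≫ prod.fst) (π₂ ≫ b) =
        (t ≫ π₁ ≫ prod.fst) ≫ prod.lift (𝟙 L) 0 := by ext <;> simp [hb₀]
    rw [reassoc_of% this, hφ₁, Category.comp_id]
  · have : t ≫ prod.lift (π₁ ≫ prod.fst) (π₂ ≫ b) = (t ≫ π₂) ≫ prod.lift s₁ b := by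
      ext <;> simp [ht, hπ]
    rw [reassoc_of% this, hb, Category.id_comp]

lemma centralise_of_huqCommute_normalisation {A R S X Y Z V W : C} {r₁ r₂ : R ⟶ X}
    {s₁ s₂ : S ⟶ X} {f : X ⟶ Y} {g : X ⟶ Z} (hf : IsKernelPair f r₁ r₂)
    (hg : IsKernelPair g s₁ s₂) (hc : HuqCommute (normalisation r₁ r₂) (normalisation s₁ s₂))
    {q : A ⟶ kernel r₁} {β : A ⟶ S} (hA : IsPullback q β (normalisation r₁ r₂) s₁)
    {ρ₁ ρ₂ : V ⟶ A} {σ₁ σ₂ : W ⟶ A} (hρ : ρ₁ ≫ q = ρ₂ ≫ q)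
    (hσ : σ₁ ≫ β ≫ s₂ ≫ f = σ₂ ≫ β ≫ s₂ ≫ f) : Centralise ρ₁ ρ₂ σ₁ σ₂ := by
  let l := normalisation s₁ s₂
  have hm := IsPullback.of_hasPullback (l ≫ f) (l ≫ f)
  let ν := normalisation (pullback.fst (l ≫ f) (l ≫ f)) (pullback.snd (l ≫ f) (l ≫ f))
  have hν : (ν ≫ l) ≫ f = 0 := (Category.assoc _ _ _).trans (normalisation_comp_eq_zero hm)
  obtain ⟨ζ, hζ : ζ ≫ normalisation r₁ r₂ = ν ≫ l⟩ :=
    KernelFork.IsLimit.lift' (normalisationIsKernel hf) _ hν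
  have hL : HuqCommute (𝟙 (kernel s₁)) ν :=
    .of_comp_kernel (normalisationIsKernel hg) (by simpa [hζ] using hc.symm.precomp (𝟙 _) ζ)
  obtain ⟨φ, hφ₁, hφ₂⟩ := hc.exists_prod
  have hφf : φ ≫ f = prod.snd ≫ l ≫ f := prod_hom_ext_of_sections
    (by simp [reassoc_of% hφ₁, normalisation_comp_eq_zero hf]) (by simp [reassoc_of% hφ₂, l])
  obtain ⟨b, hb, hbφ, -⟩ := exists_isIso_prod_lift hg hA hφ₁ hφ₂
  have hbf : b ≫ l ≫ f = β ≫ s₂ ≫ f := by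
    rw [← reassoc_of% hbφ, hφf, prod.lift_snd_assoc]
  exact centralise_of_isIso_prod_lift hm (centralise_prod_of_huqCommute_id hm hL) hρ
    (by rw [hbf, hσ])

end ProductDecompositions

section ConditionCBar

variable {C : Type u} [Category.{v} C]

lemma centralise_of_isKernelPair_triples [HasPullbacks C] [HasBinaryProducts C]
    {R S T V W X Y : C} {r₁ r₂ : R ⟶ X} {s₁ s₂ : S ⟶ X} {f : X ⟶ Y} {a : T ⟶ R} {b : T ⟶ S}
    {ρ₁ ρ₂ : V ⟶ T} {σ₁ σ₂ : W ⟶ T} (hr : ReflexiveRelation r₁ r₂) (hs : ReflexiveRelation s₁ s₂)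
    (hf : r₁ ≫ f = r₂ ≫ f) (hT : IsPullback a b r₂ s₁) (hρ : IsKernelPair a ρ₁ ρ₂)
    (hσ : IsKernelPair (prod.lift (a ≫ r₁) (b ≫ s₂ ≫ f)) σ₁ σ₂)
    (h : Centralise ρ₁ ρ₂ σ₁ σ₂) : Centralise r₁ r₂ s₁ s₂ := by
  -- in terms of elements, `e (x, y, z) = (x, y, y)` and `d (x, y, z) = (x, x, x)`
  let e : T ⟶ T := hT.lift a ((a ≫ r₂) ≫ hs.r) (by simp [hs.reflexivity₁])
  let d : T ⟶ T := hT.lift ((a ≫ r₁) ≫ hr.r) ((a ≫ r₁) ≫ hs.r)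
    (by simp [hr.reflexivity₂, hs.reflexivity₁])
  have ea : e ≫ a = a := hT.lift_fst _ _ _
  have eb : e ≫ b = (a ≫ r₂) ≫ hs.r := hT.lift_snd _ _ _
  have da : d ≫ a = (a ≫ r₁) ≫ hr.r := hT.lift_fst _ _ _
  have db : d ≫ b = (a ≫ r₁) ≫ hs.r := hT.lift_snd _ _ _
  let ρ : T ⟶ V := hρ.lift (𝟙 T) e (by simp [ea])
  let σ : T ⟶ W := hσ.lift e d (by
    simp [prod.comp_lift, reassoc_of% ea, reassoc_of% eb, reassoc_of% da, reassoc_of% db,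
      hr.reflexivity₁, hs.reflexivity₂_assoc, hf])
  obtain ⟨θ, hθ⟩ := h.exists_isConnector (ρ := ρ) (σ := σ) (by simp [ρ, σ])
  refine IsConnector.centralise (θ := θ ≫ b ≫ s₂) ⟨fun U t ht ↦ ?_, fun U t ht ↦ ?_⟩ hT
  · have hte : t = t ≫ e := by
      refine hT.hom_ext (by simp [ea]) ?_
      have := eq_comp_refl hs (t := t ≫ b) (by simpa using ht)
      simpa [eb, hT.w] using this
    have htθ : t ≫ θ = t ≫ d := by
      simpa [σ] using hθ.eq_right t (by simpa [ρ] using hte)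
    rw [reassoc_of% htθ, reassoc_of% db]
    simp [hs.reflexivity₂]
  · have htd : t ≫ e = t ≫ d := by
      refine hT.hom_ext ?_ ?_
      · simpa [ea, da] using eq_comp_refl hr (t := t ≫ a) (by simpa using ht)
      · simp [eb, db, reassoc_of% ht]
    have htθ : t ≫ θ = t := by
      simpa [ρ] using hθ.eq_left t (by simpa [σ] using htd)
    rw [reassoc_of% htθ]

variable [HasZeroMorphisms C]

lemma isPullback_kernel_lift_of_isZero [HasPullbacks C] [HasKernels C] {R T X Z : C} {r : R ⟶ X}
    {a : T ⟶ R} {z : Z ⟶ X} (hZ : IsZero Z) (w : (pullback.fst (a ≫ r) z ≫ a) ≫ r = 0) :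
    IsPullback (kernel.lift r (pullback.fst (a ≫ r) z ≫ a) w) (pullback.fst (a ≫ r) z)
      (kernel.ι r) a where
  w := kernel.lift_ι _ _ _
  isLimit' := ⟨PullbackCone.IsLimit.mk _
    (fun c ↦ pullback.lift c.snd 0 (by simp [← reassoc_of% c.condition]))
    (fun c ↦ by simp [← cancel_mono (kernel.ι r), c.condition])
    (fun c ↦ pullback.lift_fst _ _ _)
    (fun c m _ h ↦ pullback.hom_ext (h.trans (pullback.lift_fst _ _ _).symm)
      (hZ.eq_of_tgt _ _))⟩

section Triples

variable [HasPullbacks C] {R S T X Y : C} {r₁ r₂ : R ⟶ X} {s₁ s₂ : S ⟶ X} {a : T ⟶ R} {b : T ⟶ S}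

/-- The point over `X` whose domain is the object `T = R ×_X S` of triples `(x, y, z)`, projecting
to `x`. -/
noncomputable abbrev triplesPt (hr : ReflexiveRelation r₁ r₂) (hs : ReflexiveRelation s₁ s₂)
    (hT : IsPullback a b r₂ s₁) : Pt X where
  A := T
  p := a ≫ r₁
  s := hT.lift hr.r hs.r (by simp [hr.reflexivity₂, hs.reflexivity₁])
  s_p := by simp [hr.reflexivity₁]

/-- The projection `(x, y, z) ↦ (x, y)`, as a morphism of points over `X`. -/
noncomputable def triplesPtFst (hr : ReflexiveRelation r₁ r₂) (hs : ReflexiveRelation s₁ s₂)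
    (hT : IsPullback a b r₂ s₁) : triplesPt hr hs hT ⟶ relationPt hr :=
  Pt.homMk a rfl (hT.lift_fst _ _ _)

/-- The morphism `(x, y, z) ↦ (x, f z)` of points over `X`. -/
noncomputable def triplesPtThd [HasBinaryProducts C] (hr : ReflexiveRelation r₁ r₂)
    (hs : ReflexiveRelation s₁ s₂) (hT : IsPullback a b r₂ s₁) (f : X ⟶ Y) :
    triplesPt hr hs hT ⟶ graphPt f :=
  Pt.homMk (prod.lift (a ≫ r₁) (b ≫ s₂ ≫ f)) (prod.lift_fst _ _)
    (by simp [prod.comp_lift, hr.reflexivity₁, reassoc_of% hs.reflexivity₂])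

end Triples

lemma centralise_changeOfBase_triplesPt [SemiAbelian C] {R S T X Y Y' Z : C} {r₁ r₂ : R ⟶ X}
    {s₁ s₂ : S ⟶ X} {f : X ⟶ Y} {g : X ⟶ Y'} {a : T ⟶ R} {b : T ⟶ S}
    (hr : ReflexiveRelation r₁ r₂) (hs : ReflexiveRelation s₁ s₂) (hT : IsPullback a b r₂ s₁)
    (hf : IsKernelPair f r₁ r₂) (hg : IsKernelPair g s₁ s₂)
    (hN : HuqCommute (normalisation r₁ r₂) (normalisation s₁ s₂)) (hZ : IsZero Z) (z : Z ⟶ X)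
    {V W : Pt X} {ρ₁ ρ₂ : V ⟶ triplesPt hr hs hT} {σ₁ σ₂ : W ⟶ triplesPt hr hs hT}
    (hρ : ρ₁ ≫ triplesPtFst hr hs hT = ρ₂ ≫ triplesPtFst hr hs hT)
    (hσ : σ₁ ≫ triplesPtThd hr hs hT f = σ₂ ≫ triplesPtThd hr hs hT f) :
    Centralise (Pt.pullbackMap z ρ₁) (Pt.pullbackMap z ρ₂) (Pt.pullbackMap z σ₁)
      (Pt.pullbackMap z σ₂) := by
  have w : (pullback.fst (a ≫ r₁) z ≫ a) ≫ r₁ = 0 := by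
    rw [Category.assoc, pullback.condition, hZ.eq_of_tgt (pullback.snd _ _) 0, zero_comp]
  have hρ' : ρ₁.hom ≫ a = ρ₂.hom ≫ a := congr(Pt.Hom.hom $hρ)
  have hσ' : σ₁.hom ≫ b ≫ s₂ ≫ f = σ₂.hom ≫ b ≫ s₂ ≫ f := by
    simpa [triplesPtThd] using congr(Pt.Hom.hom $hσ ≫ prod.snd)
  have hA : IsPullback (kernel.lift r₁ (pullback.fst (a ≫ r₁) z ≫ a) w)
      (pullback.fst (a ≫ r₁) z ≫ b) (normalisation r₁ r₂) s₁ :=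
    (isPullback_kernel_lift_of_isZero hZ w).paste_vert hT
  refine centralise_of_huqCommute_normalisation hf hg hN hA ?_ ?_
  · simp only [← cancel_mono (kernel.ι r₁), Category.assoc, kernel.lift_ι]
    rw [reassoc_of% (Pt.pullbackMap_fst z ρ₁), reassoc_of% (Pt.pullbackMap_fst z ρ₂), hρ']
  · simp only [Category.assoc]
    rw [reassoc_of% (Pt.pullbackMap_fst z σ₁), reassoc_of% (Pt.pullbackMap_fst z σ₂), hσ']

open ZeroObject in
theorem ConditionCBar.smithIsHuq [SemiAbelian C] (h : ConditionCBar C) : SmithIsHuq C := by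
  intro R S X r₁ r₂ s₁ s₂ hr hs hN
  obtain ⟨Y, f, hf⟩ := SemiAbelian.exact r₁ r₂ hr
  obtain ⟨Z, g, hg⟩ := SemiAbelian.exact s₁ s₂ hs
  obtain ⟨⟨er⟩⟩ := hr
  obtain ⟨⟨es⟩⟩ := hs
  have hT := IsPullback.of_hasPullback r₂ s₁
  let a := triplesPtFst er.toReflexiveRelation es.toReflexiveRelation hT
  let b := triplesPtThd er.toReflexiveRelation es.toReflexiveRelation hT f
  have hv := IsPullback.of_hasPullback a a
  have hu := IsPullback.of_hasPullback b b
  obtain ⟨⟨ev⟩⟩ := isEquivalenceRelation_of_isKernelPair hv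
  obtain ⟨⟨eu⟩⟩ := isEquivalenceRelation_of_isKernelPair hu
  have := ev.toJointlyMono₂
  have := eu.toJointlyMono₂
  have hc : Centralise (pullback.fst a a) (pullback.snd a a) (pullback.fst b b)
      (pullback.snd b b) :=
    h (0 : (0 : C) ⟶ X) _ _ _ _ ev.isEquivalenceRelation eu.isEquivalenceRelation
      (Pt.centralise_of_hom (ev.toReflexiveRelation.map (Pt.changeOfBase _))
        (eu.toReflexiveRelation.map (Pt.changeOfBase _))
        (centralise_changeOfBase_triplesPt _ _ hT hf hg hN (isZero_zero C) _ hv.w hu.w))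
  exact centralise_of_isKernelPair_triples er.toReflexiveRelation es.toReflexiveRelation hf.w hT
    (Pt.isPullback_hom hv) (Pt.isPullback_hom hu)
    (hc.map (Pt.forget X) ev.toReflexiveRelation eu.toReflexiveRelation)

end ConditionCBar

end SmithHuq

theorem theorem1p1 (C : Type u) [Category.{v} C] [HasZeroMorphisms C] [SmithHuq.SemiAbelian C] :
    List.TFAE
      [SmithHuq.SmithIsHuq C,
       SmithHuq.ConditionC C,
       SmithHuq.ConditionCBar C,
       SmithHuq.BasicReflectsCentralisation C] := by
  tfae_have 1 → 2 := SmithHuq.SmithIsHuq.conditionC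
  tfae_have 2 → 1 := SmithHuq.ConditionC.smithIsHuq
  tfae_have 1 → 4 := SmithHuq.SmithIsHuq.basicReflectsCentralisation
  tfae_have 4 → 3 := SmithHuq.BasicReflectsCentralisation.conditionCBar
  tfae_have 3 → 1 := SmithHuq.ConditionCBar.smithIsHuq
  tfae_finish
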